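/- Let $k\ge 2$, $m\ge 1$, $n\ge 0$ be integers and $N=mk+n$. Let $S_N$ act on $\mathbb C^N$ by permuting coordinates, and consider the type $A$ Dunkl operators with parameter $c=1/k$, $$\nabla_i=\partial_{x_i}-\frac1k\sum_{j\neq i}\frac{1}{x_i-x_j}(1-s_{ij})\qquad(1\le i\le N),$$ where $s_{ij}$ exchanges $x_i$ and $x_j$. Let $$\pi=\pi_{m,k}=\{x\in\mathbb C^N: x_1=\dots=x_k,\ \dots,\ x_{(m-1)k+1}=\dots=x_{mk}\},\qquad D=\bigcup_{w\in S_N}w(\pi),$$ and let $x_0\in\pi$ be generic, i.e. every mirror $\{x_r=x_s\}$, $r\ne s$, containing $x_0$ contains $\pi$. Let $U$ be any complex vector space with a right action of $S_N$, let $P_{rs}$ be the action of the transposition $(r,s)$ on $U$, let $W_0\subset S_N$ be the parabolic subgroup generated by the transpositions of consecutive indices inside the blocks $\{(i-1)k+1,\dots,ik\}$, $1\le i\le m$, and let $U^{W_0}$ be the subspace of vectors fixed by $W_0$. Let $\mathcal C$ be the direct sum, over the points $x$ of the orbit $S_Nx_0$, of the spaces of germs at $x$ of analytic functions on $D$. The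 Dunkl operators act on $\mathcal C$ (apply $\nabla_i$ to any analytic extension to the ambient space and restrict to $D$), and on $U\otimes\mathcal C$ through the second factor. The operator $\sum_{i=1}^N\nabla_i^2$ preserves the space $(U\otimes\mathcal C)^{S_N}$ of invariants of the diagonal action $w(v\otimes f)=(v\cdot w^{-1})\otimes(wf)$, $(wf)(x)=f(w^{-1}x)$. On $\pi$ use the coordinates $$y_i=\frac{x_{(i-1)k+1}+\dots+x_{ik}}{\sqrt k}\quad(1\le i\le m),\qquad y_{m+j}=x_{mk+j}\quad(1\le j\le n).$$ Then taking the germ at $x_0$ and writing it in the coordinates $y$ is an isomorphism of $(U\otimes\mathcal C)^{S_N}$ onto $U^{W_0}\otimes\mathcal O_{y_0}$, where $\mathcal O_{y_0}$ is the space of germs of analytic functions on $\mathbb C^{m+n}$ at the coordinate vector $y_0$ of $x_0$. Under this isomorphism the operator $H_2$ induced by $\sum_{i=1}^N\nabla_i^2$ is the deformed spin Calogero–Moser operator $$\begin{aligned} H_2={}&\sum_{i=1}^{m+n}\partial_{y_i}^2+\sum_{m+1\le i<j\le m+n}\frac{2(1-\widetilde P_{ij})}{k(y_i-y_j)^2}+\sum_{i=1}^m\sum_{j=m+1}^{m+n}\frac{2(k-\widetilde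 P_{ij})}{(y_i-\sqrt k\,y_j)^2}+\sum_{1\le i<j\le m}\frac{2(k^2-\widetilde P_{ij})}{(y_i-y_j)^2}\\ &-\sum_{m+1\le i<j\le m+n}\frac{2}{k(y_i-y_j)}(\partial_{y_i}-\partial_{y_j})-\sum_{i=1}^m\sum_{j=m+1}^{m+n}\frac{2}{y_i-\sqrt k\,y_j}(\partial_{y_i}-\sqrt k\,\partial_{y_j})-\sum_{1\le i<j\le m}\frac{2k}{y_i-y_j}(\partial_{y_i}-\partial_{y_j}), \end{aligned}$$ where the operators $\widetilde P_{ij}$ on $U^{W_0}$ are $$\widetilde P_{ij}=\begin{cases}P_{m(k-1)+i,\;m(k-1)+j}, & m+1\le i<j\le m+n,\\[2pt] \sum_{r=(i-1)k+1}^{ik}P_{r,\;m(k-1)+j}, & 1\le i\le m<j\le m+n,\\[2pt] \sum_{r=(i-1)k+1}^{ik}\sum_{s=(j-1)k+1}^{jk}P_{rs}, & 1\le i<j\le m.\end{cases}$$ -/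

import Mathlib

open Filter Topology MeasureTheory
open scoped TensorProduct


namespace SpinCM

/-- Averages of an analytic function over a family of contractions fixing `p` are analytic at `p`. -/
theorem analyticAt_integral_comp {E F : Type*} [NormedAddCommGroup E] [NormedSpace ℂ E]
    [NormedAddCommGroup F] [NormedSpace ℂ F] [CompleteSpace F] {g : E → F} {p : E}
    (hg : AnalyticAt ℂ g p) {A : ℝ → E →L[ℂ] E} (hA : Continuous A)
    (hA1 : ∀ t ∈ Set.Icc (0 : ℝ) 1, ‖A t‖ ≤ 1) (hAp : ∀ t, A t p = p) :
    AnalyticAt ℂ (fun x => ∫ t in (0 : ℝ)..1, g (A t x)) p := by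
  obtain ⟨q, r, hq⟩ := hg
  have hcont : ∀ n, Continuous fun t : ℝ => (q n).compContinuousLinearMap (fun _ => A t) := by
    intro n
    have h1 : Continuous fun f : Fin n → (E →L[ℂ] E) => (q n).compContinuousLinearMap f :=
      (ContinuousMultilinearMap.compContinuousLinearMapContinuousMultilinear ℂ
        (fun _ : Fin n => E) (fun _ : Fin n => E) F).cont.clm_apply continuous_const
    exact h1.comp (continuous_pi fun _ => hA)
  have hio : Set.uIoc (0 : ℝ) 1 ⊆ Set.Icc 0 1 := by
    rw [Set.uIoc_of_le zero_le_one]; exact Set.Ioc_subset_Icc_self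
  have hnorm : ∀ n, ∀ t ∈ Set.Icc (0 : ℝ) 1,
      ‖(q n).compContinuousLinearMap (fun _ => A t)‖ ≤ ‖q n‖ := by
    intro n t ht
    have h7 := (q n).norm_compContinuousLinearMap_le (fun _ : Fin n => A t)
    apply h7.trans
    have : ∏ _i : Fin n, ‖A t‖ ≤ 1 := Finset.prod_le_one (fun _ _ => norm_nonneg _)
      (fun _ _ => hA1 t ht)
    simpa using mul_le_mul_of_nonneg_left this (norm_nonneg (q n))
  have hP : ∃ P : FormalMultilinearSeries ℂ E F, ∀ n,
      P n = ∫ t in (0 : ℝ)..1, (q n).compContinuousLinearMap (fun _ => A t) :=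
    ⟨fun n => ∫ t in (0 : ℝ)..1, (q n).compContinuousLinearMap (fun _ => A t), fun n => rfl⟩
  obtain ⟨P, hP⟩ := hP
  suffices HasFPowerSeriesOnBall (fun x => ∫ t in (0 : ℝ)..1, g (A t x)) P p r from ⟨P, r, this⟩
  constructor
  · have h8 : q.radius ≤ P.radius := ?_
    · exact le_trans hq.r_le h8
    apply ENNReal.le_of_forall_nnreal_lt
    intro s hs
    obtain ⟨C, -, hC⟩ := q.norm_mul_pow_le_of_lt_radius hs
    apply FormalMultilinearSeries.le_radius_of_bound _ C
    intro n
    apply le_trans _ (hC n)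
    rw [hP]
    gcongr
    have := intervalIntegral.norm_integral_le_of_norm_le_const (a := (0 : ℝ)) (b := 1)
      (fun t ht => hnorm n t (hio ht))
    simpa using this
  · exact hq.r_pos
  · intro y hy
    have hyr : (‖y‖₊ : ENNReal) < q.radius := by
      have : ‖y‖ₑ < r := by simpa [Metric.mem_eball] using hy
      exact lt_of_lt_of_le this hq.r_le
    have hy' : ‖y‖ₑ < r := by simpa [Metric.mem_eball] using hy
    have hcy : ∀ n, Continuous fun t : ℝ => (q n) (fun _ => A t y) := fun n =>
      (q n).cont.comp (continuous_pi fun _ => hA.clm_apply continuous_const)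
    have hle : ∀ t ∈ Set.Icc (0 : ℝ) 1, ‖A t y‖ ≤ ‖y‖ := fun t ht => by
      simpa using (A t).le_of_opNorm_le (hA1 t ht) y
    have hsum : Summable (fun n => ‖q n‖ * ‖y‖ ^ n) := by
      have h9 := q.summable_norm_mul_pow hyr
      simpa only [coe_nnnorm] using h9
    have key : HasSum (fun n => ∫ t in (0 : ℝ)..1, (q n) (fun _ => A t y))
        (∫ t in (0 : ℝ)..1, g (A t (p + y))) := by
      apply intervalIntegral.hasSum_integral_of_dominated_convergence
        (bound := fun n _ => ‖q n‖ * ‖y‖ ^ n)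
      · intro n
        exact (hcy n).aestronglyMeasurable
      · intro n
        apply Eventually.of_forall
        intro t ht
        have h6 := (q n).le_opNorm (fun _ => A t y)
        rw [Finset.prod_const, Finset.card_univ, Fintype.card_fin] at h6
        apply h6.trans
        exact mul_le_mul_of_nonneg_left
          (pow_le_pow_left₀ (norm_nonneg _) (hle t (hio ht)) n) (norm_nonneg _)
      · exact Eventually.of_forall fun t _ => hsum
      · exact intervalIntegrable_const
      · refine Eventually.of_forall fun t ht => ?_
        have h2 : A t y ∈ Metric.eball (0 : E) r := by
          have h5 : ‖A t y‖ₑ ≤ ‖y‖ₑ := enorm_le_iff_norm_le.mpr (hle t (hio ht))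
          simpa [Metric.mem_eball] using lt_of_le_of_lt h5 hy'
        have := hq.hasSum h2
        rw [map_add, hAp]
        exact this
    convert key using 2 with n
    rw [hP]
    have := (ContinuousLinearMap.intervalIntegral_comp_comm
      (ContinuousMultilinearMap.apply ℂ (fun _ : Fin n => E) F (fun _ => y))
      ((hcont n).intervalIntegrable (μ := volume) 0 1))
    exact this.symm

noncomputable section

section Germs

variable {I J : Type*} [Fintype I] [Fintype J]

/-- Functions on `ℂ^I` that are analytic at every point of `S` (hence near every point of `S`). -/
def AnFun (S : Set (I → ℂ)) : Subalgebra ℂ ((I → ℂ) → ℂ) where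
  carrier := {f | AnalyticOnNhd ℂ f S}
  mul_mem' hf hg := hf.mul hg
  add_mem' hf hg := hf.add hg
  algebraMap_mem' _ := analyticOnNhd_const

/-- Functions, analytic near `S`, that vanish at all points of `D` close to `S`. -/
def vanishing (D S : Set (I → ℂ)) : Ideal (AnFun S) where
  carrier := {f | ∀ᶠ x in 𝓝ˢ S, x ∈ D → f.1 x = 0}
  add_mem' {f g} hf hg := by
    have h1 : ∀ᶠ x in 𝓝ˢ S, x ∈ D → f.1 x = 0 := hf
    have h2 : ∀ᶠ x in 𝓝ˢ S, x ∈ D → g.1 x = 0 := hg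
    refine (h1.and h2).mono fun x h hx => ?_
    simp [h.1 hx, h.2 hx]
  zero_mem' := by simp
  smul_mem' c f hf := by
    have h1 : ∀ᶠ x in 𝓝ˢ S, x ∈ D → f.1 x = 0 := hf
    refine h1.mono fun x h hx => ?_
    simp [h hx]

theorem mem_vanishing {D S : Set (I → ℂ)} {f : AnFun S} :
    f ∈ vanishing D S ↔ ∀ x ∈ S, ∀ᶠ y in 𝓝 x, y ∈ D → f.1 y = 0 :=
  eventually_nhdsSet_iff_forall

/-- Germs near `S` of analytic functions on `D`: functions analytic near `S` in the ambient
space, two of them being identified when they coincide at the points of `D` close to `S`.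
For a finite set `S` this is the direct sum over `x ∈ S` of the spaces of germs at `x` of analytic
functions on `D`.  For `D = Set.univ` these are the usual germs of analytic functions on `ℂ^I`. -/
def AnGerm (D S : Set (I → ℂ)) : Type _ := AnFun S ⧸ vanishing D S

instance (D S : Set (I → ℂ)) : CommRing (AnGerm D S) :=
  inferInstanceAs (CommRing (AnFun S ⧸ vanishing D S))

instance (D S : Set (I → ℂ)) : Algebra ℂ (AnGerm D S) :=
  inferInstanceAs (Algebra ℂ (AnFun S ⧸ vanishing D S))

/-- The germ of a function. -/
def AnGerm.mk (D S : Set (I → ℂ)) : AnFun S →ₐ[ℂ] AnGerm D S :=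
  Ideal.Quotient.mkₐ ℂ (vanishing D S)

theorem AnGerm.mk_surjective (D S : Set (I → ℂ)) : Function.Surjective (AnGerm.mk D S) :=
  Ideal.Quotient.mk_surjective

theorem AnGerm.mk_eq_mk {D S : Set (I → ℂ)} {f g : AnFun S} :
    AnGerm.mk D S f = AnGerm.mk D S g ↔ f - g ∈ vanishing D S :=
  Ideal.Quotient.eq

/-- An operation on functions that is linear and respects the vanishing on `D` near `S`
descends to germs. -/
def AnGerm.lift {D S : Set (I → ℂ)} {D' S' : Set (J → ℂ)} (T : AnFun S → AnFun S')
    (hadd : ∀ f g, T (f + g) - (T f + T g) ∈ vanishing D' S')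
    (hsmul : ∀ (c : ℂ) f, T (c • f) - c • T f ∈ vanishing D' S')
    (h0 : ∀ f ∈ vanishing D S, T f ∈ vanishing D' S') : AnGerm D S →ₗ[ℂ] AnGerm D' S' where
  toFun := Quotient.lift (fun f => AnGerm.mk D' S' (T f)) (by
    intro f g hfg
    have h1 : f - g ∈ vanishing D S := (Submodule.quotientRel_def _).1 hfg
    have h2 := hadd g (f - g)
    have h3 := h0 _ h1
    rw [AnGerm.mk_eq_mk]
    have : T f - T g = (T (g + (f - g)) - (T g + T (f - g))) + T (f - g) := by
      rw [add_sub_cancel]; ring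
    rw [this]
    exact add_mem h2 h3)
  map_add' := by
    intro a b
    obtain ⟨f, rfl⟩ := AnGerm.mk_surjective D S a
    obtain ⟨g, rfl⟩ := AnGerm.mk_surjective D S b
    exact AnGerm.mk_eq_mk.2 (hadd f g)
  map_smul' := by
    intro c a
    obtain ⟨f, rfl⟩ := AnGerm.mk_surjective D S a
    exact AnGerm.mk_eq_mk.2 (hsmul c f)

theorem AnGerm.lift_mk {D S : Set (I → ℂ)} {D' S' : Set (J → ℂ)} (T : AnFun S → AnFun S')
    (hadd : ∀ f g, T (f + g) - (T f + T g) ∈ vanishing D' S')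
    (hsmul : ∀ (c : ℂ) f, T (c • f) - c • T f ∈ vanishing D' S')
    (h0 : ∀ f ∈ vanishing D S, T f ∈ vanishing D' S') (f : AnFun S) :
    AnGerm.lift T hadd hsmul h0 (AnGerm.mk D S f) = AnGerm.mk D' S' (T f) := rfl

/-- The partial derivative `∂_i` on germs of analytic functions on `ℂ^I`. -/
def pderivGerm (S : Set (I → ℂ)) [DecidableEq I] (i : I) :
    AnGerm Set.univ S →ₗ[ℂ] AnGerm Set.univ S :=
  AnGerm.lift
    (fun f => ⟨fun x => fderiv ℂ f.1 x (Pi.single i 1), fun x hx =>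
      AnalyticAt.fun_comp ((ContinuousLinearMap.apply ℂ ℂ (Pi.single i (1 : ℂ))).analyticAt _)
        (f.2 x hx).fderiv⟩)
    (by
      intro f g
      refine mem_vanishing.2 fun x hx => ?_
      filter_upwards [(f.2 x hx).eventually_analyticAt, (g.2 x hx).eventually_analyticAt]
        with y h1 h2 _
      have := fderiv_add h1.differentiableAt h2.differentiableAt
      simp [this])
    (by
      intro c f
      refine mem_vanishing.2 fun x hx => ?_
      filter_upwards [(f.2 x hx).eventually_analyticAt] with y h1 _
      have := fderiv_const_smul h1.differentiableAt c
      simp [this])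
    (by
      intro f hf
      refine mem_vanishing.2 fun x hx => ?_
      have h1 := (mem_vanishing.1 hf x hx).eventually_nhds
      filter_upwards [h1] with y hy _
      have : f.1 =ᶠ[𝓝 y] fun _ => 0 := by
        filter_upwards [hy] with z hz using hz trivial
      simp [this.fderiv_eq])

/-- The germ of the coordinate function `y_i`. -/
def coordGerm (D S : Set (I → ℂ)) (i : I) : AnGerm D S :=
  AnGerm.mk D S ⟨fun y => y i, fun _ _ =>
    (ContinuousLinearMap.proj (R := ℂ) (φ := fun _ : I => ℂ) i).analyticAt _⟩

/-- The function `x ↦ f (x ∘ w)`. -/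
def permFun {S : Set (I → ℂ)} (hS : ∀ w : Equiv.Perm I, ∀ x ∈ S, x ∘ w ∈ S) (w : Equiv.Perm I)
    (f : AnFun S) : AnFun S :=
  ⟨fun x => f.1 (x ∘ w), fun x hx =>
    AnalyticAt.fun_comp (f.2 (x ∘ w) (hS w x hx))
      ((ContinuousLinearMap.pi fun i =>
        (ContinuousLinearMap.proj (R := ℂ) (φ := fun _ : I => ℂ) (w i))).analyticAt x)⟩

/-- The action of a permutation on germs, `(w f)(x) = f(w⁻¹ x)`.  Permutations act on `ℂ^I` by
`w e_i = e_{w i}`, that is, `(w x)_i = x_{w⁻¹ i}`, so that `w⁻¹ x = x ∘ w`. -/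
def permGerm {D S : Set (I → ℂ)} (hD : ∀ w : Equiv.Perm I, ∀ x ∈ D, x ∘ w ∈ D)
    (hS : ∀ w : Equiv.Perm I, ∀ x ∈ S, x ∘ w ∈ S) (w : Equiv.Perm I) :
    AnGerm D S →ₗ[ℂ] AnGerm D S :=
  AnGerm.lift (permFun hS w)
    (by intro f g; exact mem_vanishing.2 fun x _ => Eventually.of_forall fun y _ => by simp [permFun])
    (by intro c f; exact mem_vanishing.2 fun x _ => Eventually.of_forall fun y _ => by simp [permFun])
    (by
      intro f hf
      refine mem_vanishing.2 fun x hx => ?_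
      have h1 := mem_vanishing.1 hf (x ∘ w) (hS w x hx)
      have h2 : Tendsto (fun y : I → ℂ => y ∘ w) (𝓝 x) (𝓝 (x ∘ w)) :=
        (continuous_pi fun i => continuous_apply (w i) : Continuous fun y : I → ℂ => y ∘ w).continuousAt
      filter_upwards [h2.eventually h1] with y hy hyD using hy (hD w y hyD))

end Germs

section Dunkl

variable {I : Type*} [Fintype I] [DecidableEq I]

/-- The divided difference `(f(x) - f(s x)) / (x_r - x_s)`, `s` being the reflection that exchanges
the coordinates `x_r` and `x_s`.  On the mirror `x_r = x_s`, where the quotient has a removable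
singularity for analytic `f`, its value is the derivative of `f` along `e_r - e_s`. -/
def divDiff (r s : I) (f : (I → ℂ) → ℂ) (x : I → ℂ) : ℂ :=
  open Classical in
  if x r = x s then fderiv ℂ f x (Pi.single r 1 - Pi.single s 1)
  else (f x - f (x ∘ Equiv.swap r s)) / (x r - x s)

/-- The Dunkl operator of type `A` with parameter `c`,
`∇_i f = ∂_i f - c ∑_{s ≠ i} (f - s_{is} f) / (x_i - x_s)`.  (The positive roots that have a
nonzero pairing with `e_i` are `±(e_i - e_s)`, `s ≠ i`, and the summand does not depend on the
sign.) -/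
def dunklFun (c : ℂ) (i : I) (f : (I → ℂ) → ℂ) (x : I → ℂ) : ℂ :=
  fderiv ℂ f x (Pi.single i 1) - c * ∑ s ∈ Finset.univ.erase i, divDiff i s f x

theorem comp_swap_eq {I : Type*} [DecidableEq I] (r s : I) (x : I → ℂ) :
    x ∘ Equiv.swap r s = x - (x r - x s) • (Pi.single r (1 : ℂ) - Pi.single s 1) := by
  ext i
  by_cases hr : i = r
  · subst hr
    by_cases hs : i = s
    · subst hs; simp
    · simp [hs]
  · by_cases hs : i = s
    · subst hs
      simp [hr]
    · simp [hr, hs, Equiv.swap_apply_of_ne_of_ne hr hs]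

theorem analyticAt_divDiff {f : (I → ℂ) → ℂ} {p : I → ℂ} {r s : I}
    (hf : AnalyticAt ℂ f p) (hf' : AnalyticAt ℂ f (p ∘ Equiv.swap r s)) :
    AnalyticAt ℂ (divDiff r s f) p := by
  have hproj : ∀ i, AnalyticAt ℂ (fun y : I → ℂ => y i) p := fun i =>
    (ContinuousLinearMap.proj (R := ℂ) (φ := fun _ : I => ℂ) i).analyticAt _
  by_cases hp : p r = p s
  swap
  · have hperm : AnalyticAt ℂ (fun y : I → ℂ => y ∘ Equiv.swap r s) p :=
      (ContinuousLinearMap.pi fun i =>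
        (ContinuousLinearMap.proj (R := ℂ) (φ := fun _ : I => ℂ) (Equiv.swap r s i))).analyticAt p
    have h1 : AnalyticAt ℂ (fun y => (f y - f (y ∘ Equiv.swap r s)) / (y r - y s)) p :=
      (hf.sub (AnalyticAt.fun_comp hf' hperm)).div ((hproj r).sub (hproj s)) (sub_ne_zero.2 hp)
    refine h1.congr ?_
    have h2 : ∀ᶠ y in 𝓝 p, y r - y s ≠ 0 :=
      ((hproj r).sub (hproj s)).continuousAt.eventually_ne (sub_ne_zero.2 hp)
    filter_upwards [h2] with y hy
    simp [divDiff, sub_ne_zero.1 hy]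
  set v : I → ℂ := Pi.single r 1 - Pi.single s 1 with hv
  let ℓ : (I → ℂ) →L[ℂ] ℂ := 
    ContinuousLinearMap.proj (R := ℂ) (φ := fun _ : I => ℂ) r -
      ContinuousLinearMap.proj (R := ℂ) (φ := fun _ : I => ℂ) s
  let A : ℝ → (I → ℂ) →L[ℂ] (I → ℂ) := fun t =>
    ContinuousLinearMap.id ℂ _ - (t : ℂ) • ℓ.smulRight v
  have hAapp : ∀ t x, A t x = x - (t : ℂ) • ((x r - x s) • v) := fun t x => by
    simp [A, ℓ]
  have hAc : Continuous A :=
    continuous_const.sub (Complex.continuous_ofReal.smul continuous_const)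
  have hA1 : ∀ t ∈ Set.Icc (0 : ℝ) 1, ‖A t‖ ≤ 1 := by
    intro t ht
    refine ContinuousLinearMap.opNorm_le_bound _ zero_le_one fun x => ?_
    rw [one_mul, pi_norm_le_iff_of_nonneg (norm_nonneg _)]
    intro i
    have hconv : A t x = (1 - t : ℂ) • x + (t : ℂ) • (x ∘ Equiv.swap r s) := by
      rw [hAapp, comp_swap_eq]; module
    have h1 : ‖(1 - t : ℂ)‖ = 1 - t := by
      rw [← Complex.ofReal_one, ← Complex.ofReal_sub, Complex.norm_real,
        Real.norm_of_nonneg (by linarith [ht.2])]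
    have h2 : ‖(t : ℂ)‖ = t := by
      rw [Complex.norm_real, Real.norm_of_nonneg ht.1]
    rw [hconv]
    calc ‖((1 - t : ℂ) • x + (t : ℂ) • (x ∘ Equiv.swap r s)) i‖
        ≤ ‖(1 - t : ℂ)‖ * ‖x i‖ + ‖(t : ℂ)‖ * ‖x (Equiv.swap r s i)‖ := by
          simp only [Pi.add_apply, Pi.smul_apply, Function.comp, smul_eq_mul, ← norm_mul]
          exact norm_add_le _ _
      _ ≤ (1 - t) * ‖x‖ + t * ‖x‖ := by
          rw [h1, h2]
          exact add_le_add (mul_le_mul_of_nonneg_left (norm_le_pi_norm x _) (by linarith [ht.2]))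
            (mul_le_mul_of_nonneg_left (norm_le_pi_norm x _) ht.1)
      _ = ‖x‖ := by ring
  have hAp : ∀ t, A t p = p := fun t => by simp [hAapp, hp]
  have hd : AnalyticAt ℂ (fun x => fderiv ℂ f x v) p :=
    AnalyticAt.fun_comp ((ContinuousLinearMap.apply ℂ ℂ v).analyticAt _) hf.fderiv
  refine (analyticAt_integral_comp hd hAc hA1 hAp).congr ?_
  obtain ⟨ε, hε, hball⟩ := Metric.eventually_nhds_iff_ball.1 hf.eventually_analyticAt
  filter_upwards [Metric.ball_mem_nhds p hε] with x hx
  have hAx : ∀ t ∈ Set.Icc (0 : ℝ) 1, AnalyticAt ℂ f (A t x) := by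
    intro t ht
    apply hball
    rw [mem_ball_iff_norm] at hx ⊢
    have : A t x - p = A t (x - p) := by rw [map_sub, hAp]
    rw [this]
    exact lt_of_le_of_lt (by simpa using (A t).le_of_opNorm_le (hA1 t ht) (x - p)) hx
  by_cases hxrs : x r = x s
  · have : ∀ t, A t x = x := fun t => by simp [hAapp, hxrs]
    simp [this, divDiff, hxrs, hv]
  · have hne : x r - x s ≠ 0 := sub_ne_zero.2 hxrs
    have hderiv : ∀ t ∈ Set.uIcc (0 : ℝ) 1,
        HasDerivAt (fun t : ℝ => f (A t x)) (-((x r - x s) * fderiv ℂ f (A t x) v)) t := by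
      intro t ht
      rw [Set.uIcc_of_le zero_le_one] at ht
      have h1 : HasDerivAt (fun t : ℝ => A t x) (-((x r - x s) • v)) t := by
        have h2 : HasDerivAt (fun t : ℝ => (t : ℂ)) 1 t := Complex.ofRealCLM.hasDerivAt
        have h3 := (h2.smul_const ((x r - x s) • v)).const_sub x
        simpa [hAapp] using h3
      have h4 := ((hAx t ht).differentiableAt.hasFDerivAt.restrictScalars ℝ).comp_hasDerivAt t h1
      simpa [Function.comp_def] using h4
    have hcont : ContinuousOn (fun t : ℝ => -((x r - x s) * fderiv ℂ f (A t x) v))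
        (Set.uIcc 0 1) := by
      intro t ht
      rw [Set.uIcc_of_le zero_le_one] at ht
      have h1 : ContinuousAt (fun t : ℝ => A t x) t :=
        (hAc.clm_apply continuous_const).continuousAt
      have h2 : ContinuousAt (fun y => fderiv ℂ f y v) (A t x) :=
        (AnalyticAt.fun_comp ((ContinuousLinearMap.apply ℂ ℂ v).analyticAt _)
          (hAx t ht).fderiv).continuousAt
      have h3 : ContinuousAt (fun t : ℝ => fderiv ℂ f (A t x) v) t :=
        ContinuousAt.comp (f := fun t : ℝ => A t x) (g := fun y => fderiv ℂ f y v) h2 h1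
      exact ((continuousAt_const.mul h3).neg).continuousWithinAt
    have hint := intervalIntegral.integral_eq_sub_of_hasDerivAt hderiv hcont.intervalIntegrable
    have hA0 : A 0 x = x := by simp [hAapp]
    have hA1' : A 1 x = x ∘ Equiv.swap r s := by rw [hAapp, comp_swap_eq]; simp [hv]
    rw [intervalIntegral.integral_neg, intervalIntegral.integral_const_mul, hA0, hA1'] at hint
    rw [divDiff, if_neg hxrs, eq_div_iff hne]
    linear_combination -hint

theorem analyticAt_dunklFun {S : Set (I → ℂ)} (hS : ∀ w : Equiv.Perm I, ∀ x ∈ S, x ∘ w ∈ S)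
    (c : ℂ) (i : I) {f : (I → ℂ) → ℂ} (hf : AnalyticOnNhd ℂ f S) :
    AnalyticOnNhd ℂ (dunklFun c i f) S := by
  intro p hp
  have h1 : AnalyticAt ℂ (fun x => fderiv ℂ f x (Pi.single i 1)) p :=
    AnalyticAt.fun_comp ((ContinuousLinearMap.apply ℂ ℂ (Pi.single i (1 : ℂ))).analyticAt _)
      (hf p hp).fderiv
  have h2 : AnalyticAt ℂ (fun x => ∑ s ∈ Finset.univ.erase i, divDiff i s f x) p :=
    Finset.analyticAt_fun_sum _ fun s _ =>
      analyticAt_divDiff (hf p hp) (hf _ (hS (Equiv.swap i s) p hp))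
  exact h1.sub (analyticAt_const.mul h2)

theorem dunklFun_add (c : ℂ) (i : I) {f g : (I → ℂ) → ℂ} {x : I → ℂ}
    (hf : DifferentiableAt ℂ f x) (hg : DifferentiableAt ℂ g x) :
    dunklFun c i (f + g) x = dunklFun c i f x + dunklFun c i g x := by
  have h : ∀ s, divDiff i s (f + g) x = divDiff i s f x + divDiff i s g x := by
    intro s
    simp only [divDiff, fderiv_add hf hg]
    split_ifs
    · simp
    · simp; ring
  simp only [dunklFun, h, fderiv_add hf hg, Finset.sum_add_distrib, add_apply]
  ring

theorem dunklFun_smul (c : ℂ) (i : I) (a : ℂ) {f : (I → ℂ) → ℂ} {x : I → ℂ}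
    (hf : DifferentiableAt ℂ f x) :
    dunklFun c i (a • f) x = a * dunklFun c i f x := by
  have h : ∀ s, divDiff i s (a • f) x = a * divDiff i s f x := by
    intro s
    simp only [divDiff, fderiv_const_smul hf a]
    split_ifs
    · simp [mul_sub]
    · simp; ring
  simp only [dunklFun, h, fderiv_const_smul hf a, ← Finset.mul_sum]
  simp
  ring

theorem dunklFun_comp_perm (c : ℂ) (i : I) (w : Equiv.Perm I) (f : (I → ℂ) → ℂ) (x : I → ℂ) :
    dunklFun c (w i) (fun y => f (y ∘ w)) x = dunklFun c i f (x ∘ w) := by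
  let e : (I → ℂ) ≃L[ℂ] (I → ℂ) := (LinearEquiv.funCongrLeft ℂ ℂ w).toContinuousLinearEquiv
  have he : ∀ y, e y = y ∘ w := fun y => rfl
  have hfd : ∀ j, fderiv ℂ (fun y => f (y ∘ w)) x (Pi.single (w j) 1)
      = fderiv ℂ f (x ∘ w) (Pi.single j 1) := by
    intro j
    have h1 : fderiv ℂ (f ∘ e) x = (fderiv ℂ f (e x)).comp (e : (I → ℂ) →L[ℂ] (I → ℂ)) :=
      e.comp_right_fderiv
    have h2 : (Pi.single (w j) (1 : ℂ) : I → ℂ) ∘ w = Pi.single j 1 := by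
      ext l; simp [Pi.single_apply]
    have h3 := congrArg (fun L => L (Pi.single (w j) (1 : ℂ))) h1
    simp only [ContinuousLinearMap.comp_apply, ContinuousLinearEquiv.coe_coe, he, h2] at h3
    exact h3
  have hdd : ∀ s, divDiff (w i) (w s) (fun y => f (y ∘ w)) x = divDiff i s f (x ∘ w) := by
    intro s
    have h2 : (x ∘ Equiv.swap (w i) (w s)) ∘ w = (x ∘ w) ∘ Equiv.swap i s := by
      ext l
      simp [Function.comp, Equiv.swap_apply_apply]
    simp only [divDiff, map_sub, hfd, h2, Function.comp_apply]
  rw [dunklFun, dunklFun, hfd]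
  congr 2
  symm
  refine Finset.sum_bij (fun s _ => w s) ?_ ?_ ?_ ?_
  · intro s hs; simpa using hs
  · intro s _ t _ h; exact w.injective h
  · intro t ht; exact ⟨w.symm t, by simpa [Equiv.symm_apply_eq] using ht, by simp⟩
  · intro s _; rw [hdd]

end Dunkl

section Stratum

variable {I : Type*}

/-- The orbit of `x` under the group of all permutations of coordinates. -/
def orbit (x : I → ℂ) : Set (I → ℂ) := Set.range fun w : Equiv.Perm I => x ∘ w

/-- The union `⋃_w w(π)` over all permutations `w` of coordinates. -/
def saturation (π : Set (I → ℂ)) : Set (I → ℂ) := {x | ∃ w : Equiv.Perm I, x ∘ w ∈ π}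

/-- A point of `π` is generic if every mirror `{x_r = x_s}` that contains it contains `π`. -/
def IsGeneric (π : Set (I → ℂ)) (x₀ : I → ℂ) : Prop :=
  x₀ ∈ π ∧ ∀ r s, x₀ r = x₀ s → ∀ x ∈ π, x r = x s

theorem orbit_perm (x₀ : I → ℂ) (w : Equiv.Perm I) (x : I → ℂ) (hx : x ∈ orbit x₀) :
    x ∘ w ∈ orbit x₀ := by
  obtain ⟨u, rfl⟩ := hx
  exact ⟨u * w, rfl⟩

theorem self_mem_orbit (x₀ : I → ℂ) : x₀ ∈ orbit x₀ := ⟨1, rfl⟩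

theorem saturation_perm (π : Set (I → ℂ)) (w : Equiv.Perm I) (x : I → ℂ)
    (hx : x ∈ saturation π) : x ∘ w ∈ saturation π := by
  obtain ⟨u, hu⟩ := hx
  refine ⟨w⁻¹ * u, ?_⟩
  have : (x ∘ w) ∘ ⇑(w⁻¹ * u) = x ∘ u := by ext i; simp
  rwa [this]

theorem subset_saturation (π : Set (I → ℂ)) : π ⊆ saturation π := fun _ hx => ⟨1, hx⟩

/-- The functions vanishing on the stratum are stable under the Dunkl operators with `c = 1/k`,
if the coordinates are constant on `π` along blocks of sizes `k` and `1`. -/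
theorem dunklFun_vanishing [Fintype I] [DecidableEq I] {π : Set (I → ℂ)} {k : ℕ} (hk : k ≠ 0)
    (hπ : ∀ x : I → ℂ, (∀ r s, (∀ y ∈ π, y r = y s) → x r = x s) → x ∈ π)
    (hcard : ∀ i, Nat.card {s // ∀ y ∈ π, y i = y s} = k ∨ Nat.card {s // ∀ y ∈ π, y i = y s} = 1)
    {x₀ : I → ℂ} (hx₀ : IsGeneric π x₀) (i : I) {f : (I → ℂ) → ℂ}
    (hf : AnalyticOnNhd ℂ f (orbit x₀))
    (hv : ∀ p ∈ orbit x₀, ∀ᶠ y in 𝓝 p, y ∈ saturation π → f y = 0) :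
    ∀ p ∈ orbit x₀, ∀ᶠ y in 𝓝 p, y ∈ saturation π → dunklFun (1 / (k : ℂ)) i f y = 0 := by
  classical
  intro p hp
  have E1 := (hv p hp).eventually_nhds
  have E2 : ∀ᶠ y in 𝓝 p, ∀ s, y ∘ Equiv.swap i s ∈ saturation π → f (y ∘ Equiv.swap i s) = 0 := by
    rw [eventually_all]
    intro s
    have h2 : Tendsto (fun y : I → ℂ => y ∘ Equiv.swap i s) (𝓝 p) (𝓝 (p ∘ Equiv.swap i s)) :=
      (continuous_pi fun j => continuous_apply (Equiv.swap i s j) :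
        Continuous fun y : I → ℂ => y ∘ Equiv.swap i s).continuousAt
    exact h2.eventually (hv _ (orbit_perm x₀ _ p hp))
  have E3 : ∀ᶠ y in 𝓝 p, ∀ r s, y r = y s → p r = p s := by
    rw [eventually_all]; intro r
    rw [eventually_all]; intro s
    by_cases h : p r = p s
    · simp [h]
    · have h1 : ContinuousAt (fun y : I → ℂ => y r - y s) p :=
        ((continuous_apply r).sub (continuous_apply s)).continuousAt
      filter_upwards [h1.eventually_ne (sub_ne_zero.2 h)] with y hy hy'
      exact absurd (sub_eq_zero.2 hy') hy
  filter_upwards [E1, E2, E3, (hf p hp).eventually_analyticAt] with y h1 h2 h3 h4 hyD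
  obtain ⟨u, rfl⟩ := hp
  obtain ⟨w, hw⟩ := hyD
  -- the coincidences of coordinates of `y` are exactly those of `x₀ ∘ u`
  have key : ∀ r s, (∀ z ∈ π, z (u r) = z (u s)) ↔ y r = y s := by
    let T₀ : Finset (I × I) := Finset.univ.filter fun q => ∀ z ∈ π, z q.1 = z q.2
    let T : Equiv.Perm I → Finset (I × I) := fun g =>
      Finset.univ.filter fun q => ∀ z ∈ π, z (g q.1) = z (g q.2)
    have hT : ∀ g, (T g).card = T₀.card := by
      intro g
      refine Finset.card_bij (fun q _ => (g q.1, g q.2)) ?_ ?_ ?_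
      · intro q hq
        simp only [T, Finset.mem_filter, Finset.mem_univ, true_and] at hq
        simp only [T₀, Finset.mem_filter, Finset.mem_univ, true_and]
        exact hq
      · rintro ⟨a, b⟩ _ ⟨a', b'⟩ _ h
        simpa using h
      · rintro ⟨a, b⟩ hq
        simp only [T₀, Finset.mem_filter, Finset.mem_univ, true_and] at hq
        refine ⟨(g.symm a, g.symm b), ?_, by simp⟩
        simp only [T, Finset.mem_filter, Finset.mem_univ, true_and, Equiv.apply_symm_apply]
        exact hq
    have hsub1 : ∀ r s, (∀ z ∈ π, z (w⁻¹ r) = z (w⁻¹ s)) → y r = y s := by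
      intro r s h
      have := h _ hw
      simpa using this
    have hsub2 : ∀ r s, y r = y s → ∀ z ∈ π, z (u r) = z (u s) := fun r s h =>
      hx₀.2 _ _ (h3 r s h)
    have hsub : T w⁻¹ ⊆ T u := by
      intro q hq
      simp only [T, Finset.mem_filter, Finset.mem_univ, true_and] at hq ⊢
      exact hsub2 _ _ (hsub1 _ _ hq)
    have heq : T w⁻¹ = T u := Finset.eq_of_subset_of_card_le hsub (by rw [hT, hT])
    intro r s
    refine ⟨fun h => hsub1 r s ?_, hsub2 r s⟩
    have : (r, s) ∈ T u := by
      simp only [T, Finset.mem_filter, Finset.mem_univ, true_and]; exact h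
    rw [← heq] at this
    simpa only [T, Finset.mem_filter, Finset.mem_univ, true_and] using this
  let B : Finset I := Finset.univ.filter fun s => y i = y s
  have hiB : i ∈ B := by simp [B]
  have hB : B.card = k ∨ B.card = 1 := by
    have : B.card = Nat.card {s // ∀ z ∈ π, z (u i) = z s} := by
      rw [Nat.card_eq_fintype_card, Fintype.card_subtype]
      refine Finset.card_bij (fun s _ => u s) ?_ ?_ ?_
      · intro s hs
        simp only [B, Finset.mem_filter, Finset.mem_univ, true_and] at hs ⊢
        exact (key i s).2 hs
      · intro a _ b _ h; exact u.injective h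
      · intro b hb
        simp only [Finset.mem_filter, Finset.mem_univ, true_and] at hb
        refine ⟨u.symm b, ?_, by simp⟩
        simp only [B, Finset.mem_filter, Finset.mem_univ, true_and]
        exact (key i _).1 (by simpa using hb)
    rw [this]; exact hcard (u i)
  have hf0 : f y = 0 := h1.self_of_nhds ⟨w, hw⟩
  -- the derivative along the block of `i` vanishes
  have hder : ∑ s ∈ B, fderiv ℂ f y (Pi.single s 1) = 0 := by
    rw [← map_sum]
    set v : I → ℂ := ∑ s ∈ B, Pi.single s (1 : ℂ) with hv'
    have hvapp : ∀ r, v r = if y i = y r then 1 else 0 := by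
      intro r
      simp [hv', Finset.sum_apply, Pi.single_apply, B]
    have hline : HasDerivAt (fun t : ℂ => y + t • v) v 0 := by
      simpa using ((hasDerivAt_id (0 : ℂ)).smul_const v).const_add y
    have hcomp : HasDerivAt (fun t : ℂ => f (y + t • v)) (fderiv ℂ f y v) 0 := by
      have h5 : HasFDerivAt f (fderiv ℂ f y) (y + (0 : ℂ) • v) := by
        simpa using h4.differentiableAt.hasFDerivAt
      exact h5.comp_hasDerivAt 0 hline
    have hzero : (fun t : ℂ => f (y + t • v)) =ᶠ[𝓝 0] fun _ => 0 := by
      have h6 : Tendsto (fun t : ℂ => y + t • v) (𝓝 0) (𝓝 y) := by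
        simpa using hline.continuousAt.tendsto
      filter_upwards [h6.eventually h1] with t ht
      refine ht ⟨u⁻¹, hπ _ fun r s hrs => ?_⟩
      have h7 : y (u⁻¹ r) = y (u⁻¹ s) := (key _ _).1 (by simpa using hrs)
      simp only [Function.comp_apply, Pi.add_apply, Pi.smul_apply, hvapp, h7]
    exact hcomp.unique ((hasDerivAt_const (0 : ℂ) (0 : ℂ)).congr_of_eventuallyEq hzero)
  have hdd : ∀ s ∈ Finset.univ.erase i, divDiff i s f y =
      if s ∈ B then fderiv ℂ f y (Pi.single i 1) - fderiv ℂ f y (Pi.single s 1) else 0 := by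
    intro s _
    by_cases h : y i = y s
    · simp [divDiff, h, B]
    · have h8 : f (y ∘ Equiv.swap i s) = 0 := h2 s (saturation_perm π _ y ⟨w, hw⟩)
      simp [divDiff, h, B, hf0, h8]
  have hk' : (k : ℂ) ≠ 0 := Nat.cast_ne_zero.2 hk
  have hsum : ∑ s ∈ Finset.univ.erase i, divDiff i s f y
      = (B.card : ℂ) * fderiv ℂ f y (Pi.single i 1) := by
    rw [Finset.sum_congr rfl hdd]
    have h9 : ∑ s ∈ Finset.univ.erase i,
        (if s ∈ B then fderiv ℂ f y (Pi.single i 1) - fderiv ℂ f y (Pi.single s 1) else 0)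
        = ∑ s ∈ B, (fderiv ℂ f y (Pi.single i 1) - fderiv ℂ f y (Pi.single s 1)) := by
      rw [Finset.sum_erase _ (by simp), Finset.sum_ite_mem, Finset.univ_inter]
    rw [h9, Finset.sum_sub_distrib, hder, Finset.sum_const, nsmul_eq_mul, sub_zero]
  rw [dunklFun, hsum]
  rcases hB with hB | hB
  · rw [hB]; field_simp; ring
  · have hB1 : B = {i} := by
      obtain ⟨a, ha⟩ := Finset.card_eq_one.1 hB
      rw [ha] at hiB ⊢
      rw [Finset.mem_singleton.1 hiB]
    rw [hB1, Finset.sum_singleton] at hder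
    rw [hder]; simp

end Stratum

section TypeA

variable {m k n : ℕ}

/-- The index of the `a`-th coordinate of the `i`-th block (counting from zero: `i k + a`). -/
def blk (i : Fin m) (a : Fin k) : Fin (m * k + n) := Fin.castAdd n (finProdFinEquiv (i, a))

/-- The index of the `j`-th coordinate outside of the blocks (counting from zero: `m k + j`). -/
def free (j : Fin n) : Fin (m * k + n) := Fin.natAdd (m * k) j

/-- The subspace `π_{m,k}` of `ℂ^N`, `N = m k + n`: the coordinates are constant along each of the
first `m` blocks of `k` consecutive coordinates. -/
def stratum (m k n : ℕ) : Set (Fin (m * k + n) → ℂ) :=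
  {x | ∀ (i : Fin m) (a b : Fin k), x (blk i a) = x (blk i b)}

/-- The coordinates `y` of a point: `y_i` is the sum over the `i`-th block divided by `√k`,
followed by the coordinates outside of the blocks. -/
def yCoord (x : Fin (m * k + n) → ℂ) : Fin (m + n) → ℂ :=
  Fin.addCases (fun i => (∑ a, x (blk i a)) / (Real.sqrt k : ℂ)) (fun j => x (free j))

/-- The point of `π_{m,k}` with given coordinates `y`. -/
def param (y : Fin (m + n) → ℂ) : Fin (m * k + n) → ℂ :=
  Fin.addCases (fun b => y (Fin.castAdd n (finProdFinEquiv.symm b).1) / (Real.sqrt k : ℂ))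
    (fun j => y (Fin.natAdd m j))

theorem index_cases (r : Fin (m * k + n)) : (∃ i a, r = blk i a) ∨ ∃ j, r = free j := by
  refine Fin.addCases (fun b => Or.inl ?_) (fun j => Or.inr ⟨j, rfl⟩) r
  exact ⟨(finProdFinEquiv.symm b).1, (finProdFinEquiv.symm b).2, by
    rw [blk, Prod.mk.eta, Equiv.apply_symm_apply]⟩

theorem blk_inj {i i' : Fin m} {a a' : Fin k} :
    (blk i a : Fin (m * k + n)) = blk i' a' ↔ i = i' ∧ a = a' := by
  simp [blk]

theorem free_inj {j j' : Fin n} : (free j : Fin (m * k + n)) = free j' ↔ j = j' := by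
  simp [free]

theorem blk_ne_free (i : Fin m) (a : Fin k) (j : Fin n) :
    (blk i a : Fin (m * k + n)) ≠ free j := by
  intro h
  have h1 := congrArg Fin.val h
  simp only [blk, free, Fin.val_castAdd, Fin.val_natAdd] at h1
  have := (finProdFinEquiv (i, a)).isLt
  omega

theorem param_blk (y : Fin (m + n) → ℂ) (i : Fin m) (a : Fin k) :
    (param y : Fin (m * k + n) → ℂ) (blk i a) = y (Fin.castAdd n i) / (Real.sqrt k : ℂ) := by
  rw [param, blk, Fin.addCases_left, Equiv.symm_apply_apply]

theorem param_free (y : Fin (m + n) → ℂ) (j : Fin n) :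
    (param y : Fin (m * k + n) → ℂ) (free j) = y (Fin.natAdd m j) := by
  simp [param, free]

theorem param_mem (y : Fin (m + n) → ℂ) : param y ∈ stratum m k n := fun i a b => by
  rw [param_blk, param_blk]

theorem sqrt_mul_sqrt (k : ℕ) : (Real.sqrt k : ℂ) * (Real.sqrt k : ℂ) = k := by
  rw [← Complex.ofReal_mul, Real.mul_self_sqrt (Nat.cast_nonneg k)]; simp

theorem param_yCoord (hk : 2 ≤ k) {x : Fin (m * k + n) → ℂ} (hx : x ∈ stratum m k n) :
    param (yCoord x) = x := by
  have hk0 : (k : ℂ) ≠ 0 := by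
    have : k ≠ 0 := by omega
    exact_mod_cast this
  ext r
  rcases index_cases r with ⟨i, a, rfl⟩ | ⟨j, rfl⟩
  · rw [param_blk]
    have h1 : ∑ b, x (blk i b) = k * x (blk i a) := by
      rw [Finset.sum_congr rfl fun b _ => hx i b a]
      simp
    simp only [yCoord, Fin.addCases_left, h1]
    rw [div_div, sqrt_mul_sqrt]
    field_simp
  · rw [param_free]; simp [yCoord]

theorem yCoord_param (hk : 2 ≤ k) (y : Fin (m + n) → ℂ) :
    yCoord (param y : Fin (m * k + n) → ℂ) = y := by
  have hk0 : (k : ℂ) ≠ 0 := by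
    have : k ≠ 0 := by omega
    exact_mod_cast this
  ext r
  refine Fin.addCases (fun i => ?_) (fun j => ?_) r
  · simp only [yCoord, Fin.addCases_left, param_blk, Finset.sum_const, Finset.card_univ,
      Fintype.card_fin, nsmul_eq_mul]
    rw [mul_div_assoc', div_div, sqrt_mul_sqrt]
    field_simp
  · simp [yCoord, param_free]

theorem coincide_blk (i : Fin m) (a : Fin k) (s : Fin (m * k + n)) :
    (∀ x ∈ stratum m k n, x (blk i a) = x s) ↔ ∃ b, s = blk i b := by
  constructor
  · intro h
    have h1 : (fun r => if ∃ b, r = blk i b then (1 : ℂ) else 0) ∈ stratum m k n := by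
      intro i' a' b'
      simp [blk_inj]
    have h2 := h _ h1
    by_contra hs
    simp [blk_inj, hs] at h2
  · rintro ⟨b, rfl⟩ x hx
    exact hx i a b

theorem coincide_free (j : Fin n) (s : Fin (m * k + n)) :
    (∀ x ∈ stratum m k n, x (free j) = x s) ↔ s = free j := by
  constructor
  · intro h
    have h1 : (fun r => if r = free j then (1 : ℂ) else 0) ∈ stratum m k n := by
      intro i' a' b'
      simp [blk_ne_free]
    have h2 := h _ h1
    by_contra hs
    simp [hs] at h2
  · rintro rfl x _
    rfl

theorem card_coincide (r : Fin (m * k + n)) :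
    Nat.card {s // ∀ x ∈ stratum m k n, x r = x s} = k ∨
      Nat.card {s // ∀ x ∈ stratum m k n, x r = x s} = 1 := by
  rcases index_cases r with ⟨i, a, rfl⟩ | ⟨j, rfl⟩
  · left
    simp only [coincide_blk]
    have h := Nat.card_eq_of_bijective
      (fun b : Fin k => (⟨blk i b, b, rfl⟩ : {s : Fin (m * k + n) // ∃ b, s = blk i b}))
      ⟨fun b b' h => (blk_inj.1 (congrArg Subtype.val h)).2, fun ⟨s, b, hb⟩ =>
        ⟨b, Subtype.ext hb.symm⟩⟩
    rw [← h, Nat.card_fin]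
  · right
    simp only [coincide_free]
    simp

theorem mem_stratum_of_coincide (x : Fin (m * k + n) → ℂ)
    (h : ∀ r s, (∀ y ∈ stratum m k n, y r = y s) → x r = x s) : x ∈ stratum m k n :=
  fun i a b => h _ _ fun _ hy => hy i a b

/-- The space of germs of analytic functions near the orbit of `x₀` on the union of all the
images of `π_{m,k}` under `S_N`. -/
abbrev StratumGerm (m k n : ℕ) (x₀ : Fin (m * k + n) → ℂ) : Type :=
  AnGerm (saturation (stratum m k n)) (orbit x₀)

variable {x₀ : Fin (m * k + n) → ℂ}

/-- The Dunkl operator `∇_i` with parameter `c = 1/k`, acting on germs of analytic functions on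
the union of the images of `π_{m,k}`: it is applied to any analytic extension to the ambient
space, and the result is restricted. -/
def dunkl (hk : 2 ≤ k) (hx₀ : IsGeneric (stratum m k n) x₀) (i : Fin (m * k + n)) :
    StratumGerm m k n x₀ →ₗ[ℂ] StratumGerm m k n x₀ :=
  AnGerm.lift
    (fun f => ⟨dunklFun (1 / (k : ℂ)) i f.1, analyticAt_dunklFun (orbit_perm x₀) _ i f.2⟩)
    (by
      intro f g
      refine mem_vanishing.2 fun x hx => ?_
      filter_upwards [(f.2 x hx).eventually_analyticAt, (g.2 x hx).eventually_analyticAt]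
        with y h1 h2 _
      have := dunklFun_add (1 / (k : ℂ)) i h1.differentiableAt h2.differentiableAt
      simp only [one_div] at this
      simp [this])
    (by
      intro c f
      refine mem_vanishing.2 fun x hx => ?_
      filter_upwards [(f.2 x hx).eventually_analyticAt] with y h1 _
      have := dunklFun_smul (1 / (k : ℂ)) i c h1.differentiableAt
      simp only [one_div] at this
      simp [this])
    (fun f hf => mem_vanishing.2
      (dunklFun_vanishing (by omega) mem_stratum_of_coincide card_coincide hx₀ i f.2
        (mem_vanishing.1 hf)))

/-- The action of `S_N` on germs, `(w f)(x) = f(w⁻¹ x)`. -/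
def permStratum (x₀ : Fin (m * k + n) → ℂ) (w : Equiv.Perm (Fin (m * k + n))) :
    StratumGerm m k n x₀ →ₗ[ℂ] StratumGerm m k n x₀ :=
  permGerm (saturation_perm _) (orbit_perm x₀) w

theorem dunkl_mk (hk : 2 ≤ k) (hx₀ : IsGeneric (stratum m k n) x₀) (i : Fin (m * k + n))
    (f : AnFun (orbit x₀)) :
    dunkl hk hx₀ i (AnGerm.mk _ _ f) = AnGerm.mk _ _
      ⟨dunklFun (1 / (k : ℂ)) i f.1, analyticAt_dunklFun (orbit_perm x₀) _ i f.2⟩ := by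
  unfold dunkl
  exact AnGerm.lift_mk ..

theorem permStratum_mk (w : Equiv.Perm (Fin (m * k + n))) (f : AnFun (orbit x₀)) :
    permStratum x₀ w (AnGerm.mk _ _ f) = AnGerm.mk _ _
      (permFun (orbit_perm x₀) w f) := by
  unfold permStratum permGerm
  exact AnGerm.lift_mk ..

/-- The operator `∑_i ∇_i²` on germs. -/
def dunklLaplacian (hk : 2 ≤ k) (hx₀ : IsGeneric (stratum m k n) x₀) :
    StratumGerm m k n x₀ →ₗ[ℂ] StratumGerm m k n x₀ :=
  ∑ i, dunkl hk hx₀ i ∘ₗ dunkl hk hx₀ i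

theorem perm_comp_dunkl (hk : 2 ≤ k) (hx₀ : IsGeneric (stratum m k n) x₀)
    (w : Equiv.Perm (Fin (m * k + n))) (i : Fin (m * k + n)) :
    permStratum x₀ w ∘ₗ dunkl hk hx₀ i = dunkl hk hx₀ (w i) ∘ₗ permStratum x₀ w := by
  apply LinearMap.ext
  intro a
  obtain ⟨f, rfl⟩ := AnGerm.mk_surjective _ _ a
  rw [LinearMap.comp_apply, LinearMap.comp_apply, dunkl_mk, permStratum_mk, permStratum_mk,
    dunkl_mk]
  apply congrArg
  apply Subtype.ext
  funext x
  exact (dunklFun_comp_perm (1 / (k : ℂ)) i w f.1 x).symm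

theorem perm_comp_dunklLaplacian (hk : 2 ≤ k) (hx₀ : IsGeneric (stratum m k n) x₀)
    (w : Equiv.Perm (Fin (m * k + n))) :
    permStratum x₀ w ∘ₗ dunklLaplacian hk hx₀ = dunklLaplacian hk hx₀ ∘ₗ permStratum x₀ w := by
  have h : ∀ i, permStratum x₀ w ∘ₗ (dunkl hk hx₀ i ∘ₗ dunkl hk hx₀ i)
      = (dunkl hk hx₀ (w i) ∘ₗ dunkl hk hx₀ (w i)) ∘ₗ permStratum x₀ w := by
    intro i
    rw [← LinearMap.comp_assoc, perm_comp_dunkl, LinearMap.comp_assoc, perm_comp_dunkl,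
      LinearMap.comp_assoc]
  apply LinearMap.ext
  intro F
  simp only [dunklLaplacian, LinearMap.comp_apply, LinearMap.sum_apply, map_sum]
  have h1 : ∀ i, permStratum x₀ w (dunkl hk hx₀ i (dunkl hk hx₀ i F))
      = dunkl hk hx₀ (w i) (dunkl hk hx₀ (w i) (permStratum x₀ w F)) := fun i =>
    LinearMap.congr_fun (h i) F
  rw [Finset.sum_congr rfl fun i _ => h1 i]
  exact Equiv.sum_comp w fun i => dunkl hk hx₀ i (dunkl hk hx₀ i (permStratum x₀ w F))

/-- The germ at `x₀`, written in the coordinates `y` on `π_{m,k}`. -/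
def germAt (hk : 2 ≤ k) (hx₀ : IsGeneric (stratum m k n) x₀) :
    StratumGerm m k n x₀ →ₗ[ℂ] AnGerm Set.univ {yCoord x₀} :=
  AnGerm.lift
    (fun f => ⟨fun y => f.1 (param y), fun y hy => by
      have hy' : (param y : Fin (m * k + n) → ℂ) = x₀ := by
        rw [Set.mem_singleton_iff.1 hy, param_yCoord hk hx₀.1]
      refine AnalyticAt.fun_comp (by rw [hy']; exact f.2 _ (self_mem_orbit x₀)) ?_
      refine AnalyticAt.pi fun r => ?_
      have hproj : ∀ i, AnalyticAt ℂ (fun y : Fin (m + n) → ℂ => y i) y := fun i =>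
        (ContinuousLinearMap.proj (R := ℂ) (φ := fun _ : Fin (m + n) => ℂ) i).analyticAt _
      rcases index_cases r with ⟨i, a, rfl⟩ | ⟨j, rfl⟩
      · simp only [param_blk, div_eq_mul_inv]
        exact (hproj _).mul analyticAt_const
      · simp only [param_free]
        exact hproj _⟩)
    (by intro f g; exact mem_vanishing.2 fun x _ => Eventually.of_forall fun y _ => by simp)
    (by intro c f; exact mem_vanishing.2 fun x _ => Eventually.of_forall fun y _ => by simp)
    (by
      intro f hf
      refine mem_vanishing.2 fun y hy => ?_
      rw [Set.mem_singleton_iff.1 hy]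
      have hc : Continuous (param : (Fin (m + n) → ℂ) → Fin (m * k + n) → ℂ) := by
        refine continuous_pi fun r => ?_
        rcases index_cases r with ⟨i, a, rfl⟩ | ⟨j, rfl⟩
        · simp only [param_blk]; exact (continuous_apply _).div_const _
        · simp only [param_free]; exact continuous_apply _
      have h1 : Tendsto (param : (Fin (m + n) → ℂ) → Fin (m * k + n) → ℂ) (𝓝 (yCoord x₀))
          (𝓝 x₀) := by
        have := hc.tendsto (yCoord x₀)
        rwa [param_yCoord hk hx₀.1] at this
      filter_upwards [h1.eventually (mem_vanishing.1 hf x₀ (self_mem_orbit x₀))] with z hz _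
      exact hz (subset_saturation _ (param_mem z)))

section Module

variable {U : Type*} [AddCommGroup U] [Module ℂ U]
  (ρ : Representation ℂ (Equiv.Perm (Fin (m * k + n)))ᵐᵒᵖ U)

/-- The space of `U`-valued germs that are invariant under the diagonal action
`w (v ⊗ f) = (v · w⁻¹) ⊗ (w f)` of `S_N`.  The right `S_N`-module structure on `U` is
`v · w = ρ (op w) v`. -/
def diagInvariants (x₀ : Fin (m * k + n) → ℂ) :
    Submodule ℂ (U ⊗[ℂ] StratumGerm m k n x₀) where
  carrier := {F | ∀ w, TensorProduct.map (ρ (MulOpposite.op w⁻¹)) (permStratum x₀ w) F = F}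
  add_mem' hF hG w := by rw [map_add, hF w, hG w]
  zero_mem' w := map_zero _
  smul_mem' c F hF w := by rw [map_smul, hF w]

/-- The operator `∑_i ∇_i²`, acting by `id ⊗ ∑_i ∇_i²` on the diagonal invariants. -/
def invLaplacian (hk : 2 ≤ k) (hx₀ : IsGeneric (stratum m k n) x₀) :
    Module.End ℂ (diagInvariants ρ x₀) :=
  ((dunklLaplacian hk hx₀).lTensor U).restrict (by
    intro F hF w
    have h : TensorProduct.map (ρ (MulOpposite.op w⁻¹)) (permStratum x₀ w) ∘ₗ
        (dunklLaplacian hk hx₀).lTensor U = (dunklLaplacian hk hx₀).lTensor U ∘ₗ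
          TensorProduct.map (ρ (MulOpposite.op w⁻¹)) (permStratum x₀ w) := by
      rw [LinearMap.lTensor, ← TensorProduct.map_comp, ← TensorProduct.map_comp,
        perm_comp_dunklLaplacian, LinearMap.comp_id, LinearMap.id_comp]
    have h1 := LinearMap.congr_fun h F
    simp only [LinearMap.comp_apply] at h1
    rw [h1, hF w])

/-- The parabolic subgroup `W₀` generated by the simple reflections, that is, transpositions of
consecutive coordinates, inside the blocks. -/
def parabolic (m k n : ℕ) : Subgroup (Equiv.Perm (Fin (m * k + n))) :=
  Subgroup.closure {w | ∃ (i : Fin m) (a b : Fin k), (b : ℕ) = a + 1 ∧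
    w = Equiv.swap (blk i a) (blk i b)}

/-- The subspace `U^{W₀}` of the vectors of `U` that are fixed by `W₀`. -/
def fixedVectors : Submodule ℂ U where
  carrier := {v | ∀ w ∈ parabolic m k n, ρ (MulOpposite.op w) v = v}
  add_mem' hu hv w hw := by rw [map_add, hu w hw, hv w hw]
  zero_mem' w _ := map_zero _
  smul_mem' c v hv w hw := by rw [map_smul, hv w hw]

/-- The action `P_{rs}` of the transposition `(r, s)` on `U`. -/
def transp (r s : Fin (m * k + n)) : Module.End ℂ U := ρ (MulOpposite.op (Equiv.swap r s))

theorem parabolic_inv_apply {w : Equiv.Perm (Fin (m * k + n))} (hw : w ∈ parabolic m k n) :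
    (∃ σ : Fin m → Equiv.Perm (Fin k), ∀ i a, w⁻¹ (blk i a) = blk i (σ i a)) ∧
      ∀ j, w⁻¹ (free j) = free j := by
  suffices H : (∃ σ : Fin m → Equiv.Perm (Fin k), ∀ i a, w (blk i a) = blk i (σ i a)) ∧
      ∀ j, w (free j) = free j by
    obtain ⟨⟨σ, hσ⟩, hf⟩ := H
    refine ⟨⟨fun i => (σ i)⁻¹, fun i a => ?_⟩, fun j => ?_⟩
    · rw [Equiv.Perm.inv_eq_iff_eq, hσ]; simp
    · rw [Equiv.Perm.inv_eq_iff_eq, hf]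
  refine Subgroup.closure_induction ?_ ?_ ?_ ?_ hw
  · rintro _ ⟨i, a, b, -, rfl⟩
    refine ⟨⟨fun i' => if i' = i then Equiv.swap a b else 1, fun i' c => ?_⟩, fun j => ?_⟩
    · by_cases h : i' = i
      · subst h
        simp only [if_true, Equiv.swap_apply_def, blk_inj, true_and]
        split_ifs <;> rfl
      · rw [Equiv.swap_apply_of_ne_of_ne] <;> simp [h, blk_inj]
    · exact Equiv.swap_apply_of_ne_of_ne (blk_ne_free _ _ _).symm (blk_ne_free _ _ _).symm
  · exact ⟨⟨fun _ => 1, fun _ _ => rfl⟩, fun _ => rfl⟩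
  · rintro u v _ _ ⟨⟨σ, hσ⟩, hf⟩ ⟨⟨τ, hτ⟩, hg⟩
    exact ⟨⟨fun i => σ i * τ i, fun i a => by simp [hσ, hτ]⟩, fun j => by simp [hf, hg]⟩
  · rintro u _ ⟨⟨σ, hσ⟩, hf⟩
    refine ⟨⟨fun i => (σ i)⁻¹, fun i a => ?_⟩, fun j => ?_⟩
    · rw [Equiv.Perm.inv_eq_iff_eq, hσ]; simp
    · rw [Equiv.Perm.inv_eq_iff_eq, hf]

theorem apply_transp {v : U} (hv : v ∈ fixedVectors ρ) {w : Equiv.Perm (Fin (m * k + n))}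
    (hw : w ∈ parabolic m k n) (r s : Fin (m * k + n)) :
    ρ (MulOpposite.op w) (transp ρ r s v) = transp ρ (w⁻¹ r) (w⁻¹ s) v := by
  have h1 : Equiv.swap r s * w = w * Equiv.swap (w⁻¹ r) (w⁻¹ s) := by
    rw [Equiv.swap_apply_apply]; group
  have h2 : ρ (MulOpposite.op w) * transp ρ r s
      = transp ρ (w⁻¹ r) (w⁻¹ s) * ρ (MulOpposite.op w) := by
    simp only [transp, ← map_mul, ← MulOpposite.op_mul, h1]
  have h3 := LinearMap.congr_fun h2 v
  simp only [Module.End.mul_apply] at h3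
  rw [h3, hv w hw]

/-- The operator `P̃_{ij}` on `U^{W₀}` for two indices `i`, `j` of blocks. -/
def transpBB (i j : Fin m) : Module.End ℂ (fixedVectors ρ) :=
  (∑ a : Fin k, ∑ b : Fin k, transp ρ (blk i a) (blk j b)).restrict (by
    intro v hv w hw
    obtain ⟨⟨σ, hσ⟩, -⟩ := parabolic_inv_apply hw
    simp only [LinearMap.sum_apply, map_sum, apply_transp ρ hv hw, hσ]
    rw [Equiv.sum_comp (σ i) fun a => ∑ b, transp ρ (blk i a) (blk j (σ j b)) v]
    refine Finset.sum_congr rfl fun a _ => ?_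
    exact Equiv.sum_comp (σ j) fun b => transp ρ (blk i a) (blk j b) v)

/-- The operator `P̃_{ij}` on `U^{W₀}` for the index `i` of a block and the index `j` of a
coordinate outside of the blocks. -/
def transpBF (i : Fin m) (j : Fin n) : Module.End ℂ (fixedVectors ρ) :=
  (∑ a : Fin k, transp ρ (blk i a) (free j)).restrict (by
    intro v hv w hw
    obtain ⟨⟨σ, hσ⟩, hf⟩ := parabolic_inv_apply hw
    simp only [LinearMap.sum_apply, map_sum, apply_transp ρ hv hw, hσ, hf]
    exact Equiv.sum_comp (σ i) fun a => transp ρ (blk i a) (free j) v)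

/-- The operator `P̃_{ij}` on `U^{W₀}` for the indices `i`, `j` of two coordinates outside of the
blocks. -/
def transpFF (i j : Fin n) : Module.End ℂ (fixedVectors ρ) :=
  (transp ρ (free i) (free j)).restrict (by
    intro v hv w hw
    rw [apply_transp ρ hv hw, (parabolic_inv_apply hw).2, (parabolic_inv_apply hw).2])

/-- The deformed spin Calogero-Moser operator, acting on `U^{W₀}`-valued germs of analytic
functions of `y = (y_1, …, y_{m+n})` at `y₀`.  The two kinds of variables are `Y i` (`i < m`) and
`Z j` (`j < n`); `M g` is the multiplication by `g`, and `inv g` is `1 / g`. -/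
def deformedCM (y₀ : Fin (m + n) → ℂ) :
    Module.End ℂ (fixedVectors ρ ⊗[ℂ] AnGerm Set.univ {y₀}) :=
  let V := fixedVectors ρ
  let inv : AnGerm Set.univ {y₀} → AnGerm Set.univ {y₀} := Ring.inverse
  let M : AnGerm Set.univ {y₀} → Module.End ℂ (AnGerm Set.univ {y₀}) := LinearMap.mulLeft ℂ
  let K : AnGerm Set.univ {y₀} := (k : AnGerm Set.univ {y₀})
  let sqrtK : ℂ := (Real.sqrt k : ℂ)
  let rootK : AnGerm Set.univ {y₀} := algebraMap ℂ _ sqrtK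
  let Y : Fin m → AnGerm Set.univ {y₀} := fun i => coordGerm _ _ (Fin.castAdd n i)
  let Z : Fin n → AnGerm Set.univ {y₀} := fun j => coordGerm _ _ (Fin.natAdd m j)
  let dY : Fin m → Module.End ℂ (AnGerm Set.univ {y₀}) := fun i => pderivGerm _ (Fin.castAdd n i)
  let dZ : Fin n → Module.End ℂ (AnGerm Set.univ {y₀}) := fun j => pderivGerm _ (Fin.natAdd m j)
  (∑ i : Fin (m + n), (pderivGerm {y₀} i ∘ₗ pderivGerm {y₀} i).lTensor V)
  + (∑ i : Fin n, ∑ j ∈ Finset.Ioi i,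
      TensorProduct.map (1 - transpFF ρ i j) (M (2 * inv (K * (Z i - Z j) ^ 2))))
  + (∑ i : Fin m, ∑ j : Fin n,
      TensorProduct.map ((k : Module.End ℂ V) - transpBF ρ i j)
        (M (2 * inv ((Y i - rootK * Z j) ^ 2))))
  + (∑ i : Fin m, ∑ j ∈ Finset.Ioi i,
      TensorProduct.map ((k : Module.End ℂ V) ^ 2 - transpBB ρ i j)
        (M (2 * inv ((Y i - Y j) ^ 2))))
  - (∑ i : Fin n, ∑ j ∈ Finset.Ioi i,
      (M (2 * inv (K * (Z i - Z j))) ∘ₗ (dZ i - dZ j)).lTensor V)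
  - (∑ i : Fin m, ∑ j : Fin n,
      (M (2 * inv (Y i - rootK * Z j)) ∘ₗ (dY i - sqrtK • dZ j)).lTensor V)
  - (∑ i : Fin m, ∑ j ∈ Finset.Ioi i,
      (M (2 * K * inv (Y i - Y j)) ∘ₗ (dY i - dY j)).lTensor V)

end Module

end TypeA

end

end SpinCM

/-! Off the mirrors, ∑ ∇_i² = Δ − c ∑ (∂_i − ∂_s)/(x_i − x_s) + c ∑ (1 − s_{is})/(x_i − x_s)², with
sums over ordered pairs i ≠ s. The derivatives taken at reflected points cancel by antisymmetry, and
the terms of order c² cancel within each triple of indices (`sum_dunklFun_dunklFun`).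

For c = 1/k the Dunkl operators preserve the functions vanishing on D, so the action on a germ may
be computed with any extension. A convenient one depends near x₀ only on the coordinates y
(`exists_representative`). There it is W₀-invariant and has equal derivatives in the directions of
one block, so pairs inside a block contribute nothing off the mirrors; by density and continuity the
resulting formula holds at all points near x₀ (`sum_dunklFun_dunklFun_near`). The remaining terms
are regular at x₀. Restricted to π and grouped by the type of the pair (free–free, block–free,
block–block), they are the terms of H_2, with translates s_{rs} f in place of the operators P_{rs}
(`sum_dunklFun_dunklFun_param`).

An invariant is determined by its germ at x₀, because S_N is transitive on the orbit. By genericity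
the stabilizer of x₀ is W₀ (`mem_parabolic_iff`), and W₀ fixes π pointwise; hence the coefficients
of the germ at x₀ lie in U^{W₀}, and conversely every such germ can be spread over the orbit. This
is the isomorphism (`invGermAt_injective`, `invGermAt_surjective`). As U is arbitrary and the tensor
product is algebraic, the arguments are identities between linear maps on scalar germs, which are
then tensored with U.

On invariants, translating the germ by s_{rs} is the same as acting by P_{rs} on the coefficients
(`rTensor_eq_lTensor_perm`). This turns the translates in the scalar formula into P_{rs}, and their
sums over blocks into the P̃_{ij} (`rTensor_deformedCM`). -/

namespace SpinCM

/-! ### The sum of the squares of the Dunkl operators off the mirrors. -/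

section DunklSquare

variable {I : Type*} [DecidableEq I]

/-- Both products are the same 3-cycle. The six ordered products of two different transpositions of
three letters are thereby reduced to two permutations. -/
theorem swap_mul_swap_rotate {i s t : I} (his : i ≠ s) (hit : i ≠ t) (hst : s ≠ t) :
    Equiv.swap i s * Equiv.swap i t = Equiv.swap s t * Equiv.swap s i := by
  ext j
  by_cases hi : j = i
  · subst hi; simp [Equiv.swap_apply_of_ne_of_ne, hit.symm, hst.symm]
  by_cases hs : j = s
  · subst hs; simp [Equiv.swap_apply_of_ne_of_ne, his, hit, hst, his.symm]
  by_cases ht : j = t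
  · subst ht; simp [Equiv.swap_apply_of_ne_of_ne, hst.symm, hit.symm]
  simp [Equiv.swap_apply_of_ne_of_ne, hi, hs, ht]

/-- Renaming the summation indices does not change the triple sum, so six times this sum is the sum
of the symmetrization. -/
theorem sum_triple_eq_zero {I : Type*} [Fintype I] {Q : I → I → I → ℂ}
    (hQ : ∀ i s t, Q i s t + Q i t s + Q s i t + Q s t i + Q t i s + Q t s i = 0) :
    ∑ i, ∑ s, ∑ t, Q i s t = 0 := by
  have e1 : ∑ i, ∑ s, ∑ t, Q i t s = ∑ i, ∑ s, ∑ t, Q i s t :=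
    Finset.sum_congr rfl fun i _ => Finset.sum_comm
  have e2 : ∑ i, ∑ s, ∑ t, Q s i t = ∑ i, ∑ s, ∑ t, Q i s t := Finset.sum_comm
  have e4 : ∑ i, ∑ s, ∑ t, Q t i s = ∑ i, ∑ s, ∑ t, Q i s t :=
    (Finset.sum_congr rfl fun i _ => Finset.sum_comm).trans e2
  have e3 : ∑ i, ∑ s, ∑ t, Q s t i = ∑ i, ∑ s, ∑ t, Q i s t := by
    rw [Finset.sum_comm]; exact e1
  have e5 : ∑ i, ∑ s, ∑ t, Q t s i = ∑ i, ∑ s, ∑ t, Q i s t :=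
    (Finset.sum_congr rfl fun i _ => Finset.sum_comm).trans e3
  have h : ∑ i, ∑ s, ∑ t, (Q i s t + Q i t s + Q s i t + Q s t i + Q t i s + Q t s i) = 0 := by
    simp only [hQ, Finset.sum_const_zero]
  simp only [Finset.sum_add_distrib, e1, e2, e3, e4, e5] at h
  linear_combination h / 6

/-- The divided difference as a plain quotient, which is zero on the mirror. -/
noncomputable def quotDiff (i s : I) (f : (I → ℂ) → ℂ) (x : I → ℂ) : ℂ :=
  (f x - f (x ∘ Equiv.swap i s)) / (x i - x s)

theorem quotDiff_self (i : I) (f : (I → ℂ) → ℂ) (x : I → ℂ) : quotDiff i i f x = 0 := by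
  simp [quotDiff]

theorem comp_swap_comp_swap (i s : I) (x : I → ℂ) :
    (x ∘ Equiv.swap i s) ∘ Equiv.swap i s = x := by
  ext j; simp

/-- The reflection changes the sign of both numerator and denominator, so a divided difference is
invariant under its own reflection. -/
theorem quotDiff_quotDiff_same (i s : I) (f : (I → ℂ) → ℂ) (x : I → ℂ) :
    quotDiff i s (quotDiff i s f) x = 0 := by
  have h : quotDiff i s f (x ∘ Equiv.swap i s) = quotDiff i s f x := by
    simp only [quotDiff, comp_swap_comp_swap, Function.comp_apply, Equiv.swap_apply_left,
      Equiv.swap_apply_right]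
    rw [← neg_sub (f x), ← neg_sub (x i), neg_div_neg_eq]
  rw [quotDiff, h, sub_self, zero_div]

/-- This removes the terms of order c². If two of the three indices coincide, every term of the
symmetrization is zero; if they are distinct, the six terms cancel by a partial fraction identity in
the three differences of coordinates. -/
theorem sum_quotDiff_quotDiff [Fintype I] (f : (I → ℂ) → ℂ) {x : I → ℂ} (hx : Function.Injective x) :
    ∑ i, ∑ s, ∑ t, quotDiff i s (quotDiff i t f) x = 0 := by
  apply sum_triple_eq_zero
  have h1 : ∀ i t, quotDiff i t (quotDiff i i f) x = 0 := fun i t => by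
    simp [quotDiff]
  intro i s t
  by_cases his : i = s
  · subst his; simp [quotDiff_self, quotDiff_quotDiff_same, h1]
  by_cases hit : i = t
  · subst hit; simp [quotDiff_self, quotDiff_quotDiff_same, h1]
  by_cases hst : s = t
  · subst hst; simp [quotDiff_self, quotDiff_quotDiff_same, h1]
  have e1 := swap_mul_swap_rotate his hit hst
  have e2 := swap_mul_swap_rotate hst (Ne.symm his) (Ne.symm hit)
  have e3 := swap_mul_swap_rotate hit his (Ne.symm hst)
  have e4 := swap_mul_swap_rotate (Ne.symm hst) (Ne.symm hit) (Ne.symm his)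
  rw [Equiv.swap_comm s i] at e1 e2 e4
  rw [Equiv.swap_comm t i, Equiv.swap_comm t s] at e2 e3 e4
  -- With `e5` and `e6` the values of `f` at doubly reflected points are only two, one for each
  -- 3-cycle on `i`, `s`, `t`.
  have e5 := e2.symm.trans e1.symm
  have e6 := e4.symm.trans e3.symm
  have d1 := sub_ne_zero.2 (hx.ne his)
  have d2 := sub_ne_zero.2 (hx.ne hit)
  have d3 := sub_ne_zero.2 (hx.ne hst)
  have d1' := sub_ne_zero.2 (hx.ne (Ne.symm his))
  have d2' := sub_ne_zero.2 (hx.ne (Ne.symm hit))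
  have d3' := sub_ne_zero.2 (hx.ne (Ne.symm hst))
  have hc : ∀ u v : Equiv.Perm I, (x ∘ u) ∘ v = x ∘ ⇑(u * v) := fun u v => rfl
  simp only [quotDiff, hc, e5, e6, ← e3, ← e1, Equiv.swap_comm s i, Equiv.swap_comm t i,
    Equiv.swap_comm t s, Function.comp_apply, Equiv.swap_apply_left, Equiv.swap_apply_right,
    Equiv.swap_apply_of_ne_of_ne (Ne.symm hit) (Ne.symm hst),
    Equiv.swap_apply_of_ne_of_ne (Ne.symm his) hst, Equiv.swap_apply_of_ne_of_ne his hit]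
  rw [← neg_sub (x i) (x s), ← neg_sub (x i) (x t), ← neg_sub (x s) (x t)]
  generalize f x = a
  generalize f (x ∘ Equiv.swap i s) = a1
  generalize f (x ∘ Equiv.swap i t) = a2
  generalize f (x ∘ Equiv.swap s t) = a3
  -- The three differences satisfy one linear relation. After it is eliminated, the coefficient of
  -- each value of `f` vanishes as a rational function of two independent variables.
  have hd : x s - x t = (x i - x t) - (x i - x s) := by ring
  rw [hd] at d3 ⊢
  generalize x i - x s = b at *
  generalize x i - x t = d at *
  field_simp
  ring

/-- No removable singularity occurs at such points, and the index `s = i` may be included in the sum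
because its quotient is 0/0 = 0. -/
theorem dunklFun_of_injective [Fintype I] (c : ℂ) (i : I) (f : (I → ℂ) → ℂ) {x : I → ℂ}
    (hx : Function.Injective x) :
    dunklFun c i f x = fderiv ℂ f x (Pi.single i 1) - c * ∑ s, quotDiff i s f x := by
  rw [dunklFun, ← Finset.sum_erase (f := fun s => quotDiff i s f x) Finset.univ (quotDiff_self i f x)]
  refine congrArg _ (congrArg _ (Finset.sum_congr rfl fun s hs => ?_))
  rw [divDiff, if_neg (hx.ne (Finset.ne_of_mem_erase hs).symm), quotDiff]

theorem eventually_injective {I : Type*} [Finite I] {x : I → ℂ} (hx : Function.Injective x) :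
    ∀ᶠ y in 𝓝 x, Function.Injective y := by
  have h : ∀ᶠ y in 𝓝 x, ∀ r s, r ≠ s → y r ≠ y s := by
    refine eventually_all.2 fun r => eventually_all.2 fun s => eventually_imp_distrib_left.2 fun h => ?_
    exact ((continuous_apply r).continuousAt.ne_iff_eventually_ne
      (continuous_apply s).continuousAt).1 (hx.ne h)
  exact h.mono fun y hy r s => not_imp_not.1 (hy r s)

/-- The permutation of coordinates as a continuous linear map. -/
noncomputable def permCLM {I : Type*} (w : Equiv.Perm I) : (I → ℂ) →L[ℂ] (I → ℂ) :=
  ContinuousLinearMap.pi fun i => ContinuousLinearMap.proj (R := ℂ) (φ := fun _ : I => ℂ) (w i)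

theorem permCLM_apply {I : Type*} (w : Equiv.Perm I) (x : I → ℂ) : permCLM w x = x ∘ w := rfl

theorem analyticAt_comp_perm {I : Type*} [Fintype I] {w : Equiv.Perm I} {f : (I → ℂ) → ℂ} {x : I → ℂ}
    (hf : AnalyticAt ℂ f (x ∘ w)) : AnalyticAt ℂ (fun y => f (y ∘ w)) x :=
  AnalyticAt.fun_comp hf ((permCLM w).analyticAt x)

theorem analyticAt_fderiv_apply {I : Type*} [Fintype I] {f : (I → ℂ) → ℂ} {x : I → ℂ}
    (hf : AnalyticAt ℂ f x) (v : I → ℂ) : AnalyticAt ℂ (fun y => fderiv ℂ f y v) x :=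
  AnalyticAt.fun_comp ((ContinuousLinearMap.apply ℂ ℂ v).analyticAt _) hf.fderiv

theorem analyticAt_coord {I : Type*} [Fintype I] (i : I) (x : I → ℂ) : AnalyticAt ℂ (fun y : I → ℂ => y i) x :=
  (ContinuousLinearMap.proj (R := ℂ) (φ := fun _ : I => ℂ) i).analyticAt _

theorem analyticAt_quotDiff [Fintype I] {i s : I} {f : (I → ℂ) → ℂ} {x : I → ℂ}
    (hx : Function.Injective x) (hf : AnalyticAt ℂ f x)
    (hf' : AnalyticAt ℂ f (x ∘ Equiv.swap i s)) : AnalyticAt ℂ (quotDiff i s f) x := by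
  by_cases h : i = s
  · subst h
    rw [show quotDiff i i f = fun _ => 0 from funext fun y => quotDiff_self i f y]
    exact analyticAt_const
  · exact (hf.sub (analyticAt_comp_perm hf')).div
      ((analyticAt_coord i x).sub (analyticAt_coord s x)) (sub_ne_zero.2 (hx.ne h))

/-- Quotient rule, together with the chain rule for the reflected copy of `f`: the reflection
carries e_i to e_s, which is why the derivative at the reflected point is along e_s. For `i = s`
both sides are zero by the convention on division. -/
theorem fderiv_quotDiff [Fintype I] {i s : I} {f : (I → ℂ) → ℂ} {x : I → ℂ}
    (hx : Function.Injective x) (hf : AnalyticAt ℂ f x)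
    (hf' : AnalyticAt ℂ f (x ∘ Equiv.swap i s)) :
    fderiv ℂ (quotDiff i s f) x (Pi.single i 1)
      = (fderiv ℂ f x (Pi.single i 1) - fderiv ℂ f (x ∘ Equiv.swap i s) (Pi.single s 1))
          / (x i - x s) - (f x - f (x ∘ Equiv.swap i s)) / (x i - x s) ^ 2 := by
  by_cases h : i = s
  · subst h
    rw [show quotDiff i i f = fun _ => 0 from funext fun y => quotDiff_self i f y]
    simp
  have hne := sub_ne_zero.2 (hx.ne h)
  have h1 : HasFDerivAt (fun y => f (y ∘ Equiv.swap i s))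
      ((fderiv ℂ f (x ∘ Equiv.swap i s)).comp (permCLM (Equiv.swap i s))) x :=
    HasFDerivAt.comp x (g := f) (f := permCLM (Equiv.swap i s))
      hf'.differentiableAt.hasFDerivAt (permCLM (Equiv.swap i s)).hasFDerivAt
  have h2 : HasFDerivAt (fun y : I → ℂ => y i - y s)
      (ContinuousLinearMap.proj (R := ℂ) (φ := fun _ : I => ℂ) i
        - ContinuousLinearMap.proj (R := ℂ) (φ := fun _ : I => ℂ) s) x :=
    ContinuousLinearMap.hasFDerivAt (ContinuousLinearMap.proj (R := ℂ) (φ := fun _ : I => ℂ) i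
        - ContinuousLinearMap.proj (R := ℂ) (φ := fun _ : I => ℂ) s)
  have h3 := (hf.differentiableAt.hasFDerivAt.sub h1).mul ((hasDerivAt_inv hne).comp_hasFDerivAt x h2)
  have h4 : (Pi.single i 1 : I → ℂ) ∘ Equiv.swap i s = Pi.single s 1 := by
    ext j
    simp [Pi.single_apply, Equiv.swap_apply_eq_iff]
  have h5 : HasFDerivAt (quotDiff i s f) _ x :=
    h3.congr_of_eventuallyEq (Eventually.of_forall fun y => div_eq_mul_inv _ _)
  rw [h5.fderiv]
  simp [permCLM_apply, h4, Ne.symm h]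
  field_simp
  ring

/-- The sum of the squares of the Dunkl operators, at points outside of the mirrors. -/
theorem sum_dunklFun_dunklFun [Fintype I] (c : ℂ) {f : (I → ℂ) → ℂ} {x : I → ℂ}
    (hx : Function.Injective x) (hf : ∀ w : Equiv.Perm I, AnalyticAt ℂ f (x ∘ w)) :
    ∑ i, dunklFun c i (dunklFun c i f) x
      = ∑ i, fderiv ℂ (fun y => fderiv ℂ f y (Pi.single i 1)) x (Pi.single i 1)
        - c * ∑ i, ∑ s, (fderiv ℂ f x (Pi.single i 1) - fderiv ℂ f x (Pi.single s 1)) / (x i - x s)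
        + c * ∑ i, ∑ s, (f x - f (x ∘ Equiv.swap i s)) / (x i - x s) ^ 2 := by
  have hf1 : AnalyticAt ℂ f x := hf 1
  -- After ∂_i², the three groups are the derivative of the divided differences, the divided
  -- differences of the derivative, and the products of two divided differences.
  have hterm : ∀ i, dunklFun c i (dunklFun c i f) x
      = fderiv ℂ (fun y => fderiv ℂ f y (Pi.single i 1)) x (Pi.single i 1)
        - c * ∑ s, ((fderiv ℂ f x (Pi.single i 1)
            - fderiv ℂ f (x ∘ Equiv.swap i s) (Pi.single s 1)) / (x i - x s)
            - (f x - f (x ∘ Equiv.swap i s)) / (x i - x s) ^ 2)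
        - c * ∑ s, (fderiv ℂ f x (Pi.single i 1)
            - fderiv ℂ f (x ∘ Equiv.swap i s) (Pi.single i 1)) / (x i - x s)
        + c ^ 2 * ∑ s, ∑ t, quotDiff i s (quotDiff i t f) x := by
    intro i
    have hG : dunklFun c i f =ᶠ[𝓝 x]
        fun y => fderiv ℂ f y (Pi.single i 1) - c * ∑ s, quotDiff i s f y :=
      (eventually_injective hx).mono fun y hy => dunklFun_of_injective c i f hy
    have hq : ∀ s, DifferentiableAt ℂ (quotDiff i s f) x := fun s =>
      (analyticAt_quotDiff hx hf1 (hf _)).differentiableAt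
    have hd : fderiv ℂ (dunklFun c i f) x (Pi.single i 1)
        = fderiv ℂ (fun y => fderiv ℂ f y (Pi.single i 1)) x (Pi.single i 1)
          - c * ∑ s, fderiv ℂ (quotDiff i s f) x (Pi.single i 1) := by
      rw [hG.fderiv_eq]
      have h1 := (analyticAt_fderiv_apply hf1 (Pi.single i 1)).differentiableAt.hasFDerivAt
      have h2 : HasFDerivAt (fun y => ∑ s, quotDiff i s f y)
          (∑ s, fderiv ℂ (quotDiff i s f) x) x :=
        HasFDerivAt.fun_sum fun s _ => (hq s).hasFDerivAt
      have h3 := h1.sub (h2.const_mul c)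
      have h4 : HasFDerivAt (fun y => fderiv ℂ f y (Pi.single i 1) - c * ∑ s, quotDiff i s f y) _ x := h3
      rw [h4.fderiv]
      simp
    have hQ : ∀ s, quotDiff i s (dunklFun c i f) x
        = (fderiv ℂ f x (Pi.single i 1)
            - fderiv ℂ f (x ∘ Equiv.swap i s) (Pi.single i 1)) / (x i - x s)
          - c * ∑ t, quotDiff i s (quotDiff i t f) x := by
      intro s
      rw [quotDiff, dunklFun_of_injective c i f hx,
        dunklFun_of_injective c i f (hx.comp (Equiv.injective _))]
      simp only [quotDiff, ← Finset.sum_div, Finset.sum_sub_distrib]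
      ring
    rw [dunklFun_of_injective c i _ hx, hd]
    simp only [hQ, fderiv_quotDiff hx hf1 (hf _), Finset.sum_sub_distrib, ← Finset.mul_sum]
    ring
  -- The numerator is symmetric in `i` and `s` and the denominator antisymmetric, so the derivatives
  -- at reflected points cancel in pairs.
  have hanti : ∑ i, ∑ s, (fderiv ℂ f (x ∘ Equiv.swap i s) (Pi.single s 1)
      + fderiv ℂ f (x ∘ Equiv.swap i s) (Pi.single i 1)) / (x i - x s) = 0 := by
    set A := ∑ i, ∑ s, (fderiv ℂ f (x ∘ Equiv.swap i s) (Pi.single s 1)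
      + fderiv ℂ f (x ∘ Equiv.swap i s) (Pi.single i 1)) / (x i - x s) with hA
    have h : A = -A := by
      conv_lhs => rw [hA, Finset.sum_comm]
      rw [hA, ← Finset.sum_neg_distrib]
      refine Finset.sum_congr rfl fun i _ => ?_
      rw [← Finset.sum_neg_distrib]
      refine Finset.sum_congr rfl fun s _ => ?_
      rw [Equiv.swap_comm s i, ← neg_sub (x i) (x s), div_neg, add_comm]
    linear_combination h / 2
  have hsymm : ∑ i, ∑ s, (fderiv ℂ f x (Pi.single i 1) - fderiv ℂ f x (Pi.single s 1)) / (x i - x s)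
      = 2 * ∑ i, ∑ s, fderiv ℂ f x (Pi.single i 1) / (x i - x s) := by
    have h : ∑ i, ∑ s, fderiv ℂ f x (Pi.single s 1) / (x i - x s)
        = - ∑ i, ∑ s, fderiv ℂ f x (Pi.single i 1) / (x i - x s) := by
      rw [Finset.sum_comm, ← Finset.sum_neg_distrib]
      refine Finset.sum_congr rfl fun i _ => ?_
      rw [← Finset.sum_neg_distrib]
      refine Finset.sum_congr rfl fun s _ => ?_
      rw [← neg_sub (x i) (x s), div_neg]
    simp only [sub_div, Finset.sum_sub_distrib, h]
    ring
  simp only [hterm, Finset.sum_add_distrib, Finset.sum_sub_distrib, ← Finset.mul_sum,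
    sum_quotDiff_quotDiff f hx, hsymm]
  simp only [sub_div, add_div, Finset.sum_add_distrib, Finset.sum_sub_distrib] at hanti ⊢
  linear_combination c * hanti

end DunklSquare

/-- The complement of each mirror is open, and dense as the preimage of ℂ ∖ {0} under an open linear
map; finitely many such sets meet in a dense set. Identities between continuous functions thus
extend from the regular points to the mirrors. -/
theorem dense_injective {I : Type*} [Finite I] : Dense {x : I → ℂ | Function.Injective x} := by
  classical
  cases nonempty_fintype I
  have h1 : ∀ q : {q : I × I // q.1 ≠ q.2}, Dense {x : I → ℂ | x q.1.1 ≠ x q.1.2} := by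
    rintro ⟨⟨r, s⟩, hrs⟩
    have hrs' : r ≠ s := hrs
    let ℓ : (I → ℂ) →L[ℂ] ℂ := ContinuousLinearMap.proj (R := ℂ) (φ := fun _ : I => ℂ) r -
      ContinuousLinearMap.proj (R := ℂ) (φ := fun _ : I => ℂ) s
    have hsurj : Function.Surjective ℓ := fun z => ⟨Pi.single r z, by simp [ℓ, hrs']⟩
    have h2 := (dense_compl_singleton (0 : ℂ)).preimage (ContinuousLinearMap.isOpenMap ℓ hsurj)
    have h3 : {x : I → ℂ | x r ≠ x s} = ℓ ⁻¹' {0}ᶜ := Set.ext fun x => sub_ne_zero.symm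
    exact h3 ▸ h2
  have h3 : ∀ q : {q : I × I // q.1 ≠ q.2}, IsOpen {x : I → ℂ | x q.1.1 ≠ x q.1.2} := fun q =>
    isOpen_ne_fun (continuous_apply _) (continuous_apply _)
  convert dense_iInter_of_isOpen h3 h1 using 1
  ext x
  simp only [Set.mem_ofPred_eq, Set.mem_iInter]
  exact ⟨fun h q => h.ne q.2, fun h r s => not_imp_not.1 fun hrs => h ⟨(r, s), hrs⟩⟩

/-! ### Extension of the formula across the mirrors. -/

section DunklSquare

variable {I : Type*} [Fintype I] [DecidableEq I]

/-- Near a point `p` where `f` does not depend on the differences of the coordinates that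
coincide at `p`, the terms with these differences drop out of the sum of the squares of the Dunkl
operators. -/
theorem sum_dunklFun_dunklFun_near (c : ℂ) {f : (I → ℂ) → ℂ} {p : I → ℂ}
    (hf : AnalyticOnNhd ℂ f (orbit p))
    (hinv : ∀ r s, p r = p s → ∀ᶠ x in 𝓝 p, f (x ∘ Equiv.swap r s) = f x)
    (hder : ∀ r s, p r = p s →
      ∀ᶠ x in 𝓝 p, fderiv ℂ f x (Pi.single r 1) = fderiv ℂ f x (Pi.single s 1)) :
    ∀ᶠ x in 𝓝 p, ∑ i, dunklFun c i (dunklFun c i f) x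
      = ∑ i, fderiv ℂ (fun y => fderiv ℂ f y (Pi.single i 1)) x (Pi.single i 1)
        - c * ∑ i, ∑ s, (if p i = p s then 0 else
          (fderiv ℂ f x (Pi.single i 1) - fderiv ℂ f x (Pi.single s 1)) / (x i - x s))
        + c * ∑ i, ∑ s, (if p i = p s then 0 else
          (f x - f (x ∘ Equiv.swap i s)) / (x i - x s) ^ 2) := by
  have hp : p ∈ orbit p := self_mem_orbit p
  have hfp := hf p hp
  -- The value of `divDiff` on a mirror fills in the removable singularity, so the operators can be
  -- iterated without leaving the functions analytic on the orbit.
  have hL : AnalyticAt ℂ (fun x => ∑ i, dunklFun c i (dunklFun c i f) x) p :=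
    Finset.analyticAt_fun_sum _ fun i _ => analyticAt_dunklFun (orbit_perm p) c i
      (analyticAt_dunklFun (orbit_perm p) c i hf) p hp
  -- Pairs whose coordinates coincide at `p` are omitted, so no remaining denominator vanishes
  -- there.
  have hR : AnalyticAt ℂ (fun x =>
      ∑ i, fderiv ℂ (fun y => fderiv ℂ f y (Pi.single i 1)) x (Pi.single i 1)
        - c * ∑ i, ∑ s, (if p i = p s then 0 else
          (fderiv ℂ f x (Pi.single i 1) - fderiv ℂ f x (Pi.single s 1)) / (x i - x s))
        + c * ∑ i, ∑ s, (if p i = p s then 0 else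
          (f x - f (x ∘ Equiv.swap i s)) / (x i - x s) ^ 2)) p := by
    refine ((Finset.analyticAt_fun_sum _ fun i _ =>
      analyticAt_fderiv_apply (analyticAt_fderiv_apply hfp _) _).sub (analyticAt_const.mul ?_)).add
        (analyticAt_const.mul ?_)
    · refine Finset.analyticAt_fun_sum _ fun i _ => Finset.analyticAt_fun_sum _ fun s _ => ?_
      split_ifs with h
      · exact analyticAt_const
      · exact ((analyticAt_fderiv_apply hfp _).sub (analyticAt_fderiv_apply hfp _)).div
          ((analyticAt_coord i p).sub (analyticAt_coord s p)) (sub_ne_zero.2 h)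
    · refine Finset.analyticAt_fun_sum _ fun i _ => Finset.analyticAt_fun_sum _ fun s _ => ?_
      split_ifs with h
      · exact analyticAt_const
      · exact (hfp.sub (analyticAt_comp_perm (hf _ ⟨_, rfl⟩))).div
          (((analyticAt_coord i p).sub (analyticAt_coord s p)).pow 2)
            (pow_ne_zero 2 (sub_ne_zero.2 h))
  have hfw : ∀ᶠ x in 𝓝 p, ∀ w : Equiv.Perm I, AnalyticAt ℂ f (x ∘ w) := by
    refine eventually_all.2 fun w => ?_
    exact ((permCLM w).continuous.tendsto p).eventually
      (hf (p ∘ w) ⟨w, rfl⟩).eventually_analyticAt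
  have hinv' : ∀ᶠ x in 𝓝 p, ∀ r s, p r = p s → f (x ∘ Equiv.swap r s) = f x :=
    eventually_all.2 fun r => eventually_all.2 fun s => eventually_imp_distrib_left.2 (hinv r s)
  have hder' : ∀ᶠ x in 𝓝 p, ∀ r s, p r = p s →
      fderiv ℂ f x (Pi.single r 1) = fderiv ℂ f x (Pi.single s 1) :=
    eventually_all.2 fun r => eventually_all.2 fun s => eventually_imp_distrib_left.2 (hder r s)
  have hreg : ∀ᶠ x in 𝓝 p, Function.Injective x →
      ∑ i, dunklFun c i (dunklFun c i f) x
      = ∑ i, fderiv ℂ (fun y => fderiv ℂ f y (Pi.single i 1)) x (Pi.single i 1)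
        - c * ∑ i, ∑ s, (if p i = p s then 0 else
          (fderiv ℂ f x (Pi.single i 1) - fderiv ℂ f x (Pi.single s 1)) / (x i - x s))
        + c * ∑ i, ∑ s, (if p i = p s then 0 else
          (f x - f (x ∘ Equiv.swap i s)) / (x i - x s) ^ 2) := by
    filter_upwards [hfw, hinv', hder'] with x h1 h2 h3 hx
    rw [sum_dunklFun_dunklFun c hx h1]
    refine congrArg₂ (· + ·) (congrArg₂ (· - ·) rfl (congrArg (c * ·)
      (Finset.sum_congr rfl fun i _ => Finset.sum_congr rfl fun s _ => ?_)))
      (congrArg (c * ·) (Finset.sum_congr rfl fun i _ => Finset.sum_congr rfl fun s _ => ?_))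
    · split_ifs with h
      · rw [h3 i s h, sub_self, zero_div]
      · rfl
    · split_ifs with h
      · rw [h2 i s h, sub_self, zero_div]
      · rfl
  filter_upwards [hL.eventually_analyticAt, hR.eventually_analyticAt, hreg.eventually_nhds]
    with x h1 h2 h3
  have : (𝓝[{x : I → ℂ | Function.Injective x}] x).NeBot :=
    mem_closure_iff_nhdsWithin_neBot.1 (dense_injective x)
  -- Both sides are continuous at `x` and agree at the regular points near `x`, which accumulate at
  -- `x`.
  refine tendsto_nhds_unique_of_eventuallyEq (l := 𝓝[{x : I → ℂ | Function.Injective x}] x) (h1.continuousAt.tendsto.mono_left nhdsWithin_le_nhds)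
    (h2.continuousAt.tendsto.mono_left nhdsWithin_le_nhds) ?_
  filter_upwards [nhdsWithin_le_nhds h3, self_mem_nhdsWithin] with y hy hy'
  exact hy hy'

end DunklSquare

/-! ### Germs and the functions that represent them. -/

section IsGermOf

variable {J : Type*} [Fintype J] {y₀ : J → ℂ}

/-- The germ `a` at `y₀` is represented by the function `φ`. -/
def IsGermOf (a : AnGerm Set.univ {y₀}) (φ : (J → ℂ) → ℂ) : Prop :=
  ∃ f : AnFun {y₀}, AnGerm.mk Set.univ {y₀} f = a ∧ f.1 =ᶠ[𝓝 y₀] φ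

namespace IsGermOf

variable {a b : AnGerm Set.univ {y₀}} {φ ψ : (J → ℂ) → ℂ}

theorem mk (f : AnFun {y₀}) : IsGermOf (AnGerm.mk Set.univ {y₀} f) f.1 := ⟨f, rfl, EventuallyEq.rfl⟩

theorem analyticAt (h : IsGermOf a φ) : AnalyticAt ℂ φ y₀ := by
  obtain ⟨f, -, hf⟩ := h
  exact (f.2 y₀ rfl).congr hf

theorem congr (h : IsGermOf a φ) (h' : φ =ᶠ[𝓝 y₀] ψ) : IsGermOf a ψ := by
  obtain ⟨f, hf, hf'⟩ := h
  exact ⟨f, hf, hf'.trans h'⟩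

/-- Equalities of germs are proved by exhibiting one function that represents both sides. -/
theorem eq (h : IsGermOf a φ) (h' : IsGermOf b φ) : a = b := by
  obtain ⟨f, rfl, hf⟩ := h
  obtain ⟨g, rfl, hg⟩ := h'
  refine AnGerm.mk_eq_mk.2 (mem_vanishing.2 fun y hy => ?_)
  rw [Set.mem_singleton_iff.1 hy]
  filter_upwards [hf, hg] with z h1 h2 _
  show f.1 z - g.1 z = 0
  rw [h1, h2, sub_self]

theorem eventuallyEq (h : IsGermOf a φ) (h' : IsGermOf a ψ) : φ =ᶠ[𝓝 y₀] ψ := by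
  obtain ⟨f, rfl, hf⟩ := h
  obtain ⟨g, hfg, hg⟩ := h'
  have h1 := mem_vanishing.1 (AnGerm.mk_eq_mk.1 hfg) y₀ rfl
  filter_upwards [hf, hg, h1] with z h2 h3 h4
  rw [← h2, ← h3]
  exact (sub_eq_zero.1 (h4 trivial)).symm

theorem zero : IsGermOf (0 : AnGerm Set.univ {y₀}) fun _ => 0 := ⟨0, map_zero _, EventuallyEq.rfl⟩

theorem add (h : IsGermOf a φ) (h' : IsGermOf b ψ) : IsGermOf (a + b) fun y => φ y + ψ y := by
  obtain ⟨f, rfl, hf⟩ := h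
  obtain ⟨g, rfl, hg⟩ := h'
  exact ⟨f + g, map_add _ _ _, hf.add hg⟩

theorem sub (h : IsGermOf a φ) (h' : IsGermOf b ψ) : IsGermOf (a - b) fun y => φ y - ψ y := by
  obtain ⟨f, rfl, hf⟩ := h
  obtain ⟨g, rfl, hg⟩ := h'
  exact ⟨f - g, map_sub _ _ _, hf.sub hg⟩

theorem mul (h : IsGermOf a φ) (h' : IsGermOf b ψ) : IsGermOf (a * b) fun y => φ y * ψ y := by
  obtain ⟨f, rfl, hf⟩ := h
  obtain ⟨g, rfl, hg⟩ := h'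
  exact ⟨f * g, map_mul _ _ _, hf.mul hg⟩

theorem pow (h : IsGermOf a φ) (l : ℕ) : IsGermOf (a ^ l) fun y => φ y ^ l := by
  obtain ⟨f, rfl, hf⟩ := h
  exact ⟨f ^ l, map_pow _ _ _, hf.pow_const l⟩

theorem smul (c : ℂ) (h : IsGermOf a φ) : IsGermOf (c • a) fun y => c * φ y := by
  obtain ⟨f, rfl, hf⟩ := h
  exact ⟨c • f, map_smul _ _ _, hf.mono fun y hy => congrArg (c * ·) hy⟩

theorem sum {ι : Type*} {s : Finset ι} {A : ι → AnGerm Set.univ {y₀}} {Φ : ι → (J → ℂ) → ℂ}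
    (h : ∀ i ∈ s, IsGermOf (A i) (Φ i)) : IsGermOf (∑ i ∈ s, A i) fun y => ∑ i ∈ s, Φ i y := by
  classical
  induction s using Finset.induction_on with
  | empty => simpa using zero
  | insert i s hi ih =>
    simp only [Finset.sum_insert hi]
    exact (h i (Finset.mem_insert_self i s)).add
      (ih fun j hj => h j (Finset.mem_insert_of_mem hj))

theorem const (c : ℂ) : IsGermOf (algebraMap ℂ (AnGerm Set.univ {y₀}) c) fun _ => c :=
  ⟨algebraMap ℂ _ c, AlgHom.commutes _ c, EventuallyEq.rfl⟩

theorem natCast (l : ℕ) : IsGermOf (l : AnGerm Set.univ {y₀}) fun _ => (l : ℂ) := by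
  simpa using const (y₀ := y₀) (l : ℂ)

theorem two : IsGermOf (2 : AnGerm Set.univ {y₀}) fun _ => 2 := by
  simpa using natCast (y₀ := y₀) 2

theorem coord (i : J) : IsGermOf (coordGerm Set.univ {y₀} i) fun y => y i :=
  ⟨_, rfl, EventuallyEq.rfl⟩

/-- `Ring.inverse` is zero on non-units. A representative that does not vanish at `y₀` has an
analytic reciprocal, so the germ is a unit and `Ring.inverse` is its true inverse. -/
theorem inverse (h : IsGermOf a φ) (h0 : φ y₀ ≠ 0) :
    IsGermOf (Ring.inverse a) fun y => (φ y)⁻¹ := by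
  have h1 : IsGermOf (AnGerm.mk Set.univ {y₀} ⟨fun y => (φ y)⁻¹, fun y hy => by
      rw [Set.mem_singleton_iff.1 hy]; exact h.analyticAt.inv h0⟩) fun y => (φ y)⁻¹ := mk _
  set b := AnGerm.mk Set.univ {y₀} ⟨fun y => (φ y)⁻¹, fun y hy => by
      rw [Set.mem_singleton_iff.1 hy]; exact h.analyticAt.inv h0⟩ with hb
  have h2 : a * b = 1 := by
    have h3 := const (y₀ := y₀) 1
    rw [map_one] at h3
    refine ((h.mul h1).congr ?_).eq h3
    filter_upwards [h.analyticAt.continuousAt.eventually_ne h0] with y hy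
    exact mul_inv_cancel₀ hy
  have h3 : Ring.inverse a = b := Ring.inverse_unit (Units.mkOfMulEqOne a b h2)
  rwa [h3]

theorem pderiv [DecidableEq J] (i : J) (h : IsGermOf a φ) :
    IsGermOf (pderivGerm {y₀} i a) fun y => fderiv ℂ φ y (Pi.single i 1) := by
  obtain ⟨f, rfl, hf⟩ := h
  refine ⟨_, (AnGerm.lift_mk _ _ _ _ f).symm, ?_⟩
  exact hf.fderiv.mono fun y hy => congrArg (fun L : (J → ℂ) →L[ℂ] ℂ => L (Pi.single i 1)) hy

end IsGermOf

end IsGermOf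

/-! ### Germs on the stratum, their translates, and the stabilizer of the base point. -/

section StratumGerms

variable {m k n : ℕ}

/-- The coordinates `y` as a continuous linear map. -/
noncomputable def yCLM (m k n : ℕ) : (Fin (m * k + n) → ℂ) →L[ℂ] (Fin (m + n) → ℂ) :=
  LinearMap.toContinuousLinearMap
    { toFun := yCoord
      map_add' := fun x x' => by
        ext r
        refine Fin.addCases (fun i => ?_) (fun j => ?_) r
        · simp [yCoord, Finset.sum_add_distrib, add_div]
        · simp [yCoord]
      map_smul' := fun c x => by
        ext r
        refine Fin.addCases (fun i => ?_) (fun j => ?_) r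
        · simp [yCoord, ← Finset.mul_sum, mul_div_assoc]
        · simp [yCoord] }

theorem yCLM_apply (x : Fin (m * k + n) → ℂ) : yCLM m k n x = yCoord x := rfl

theorem continuous_yCoord : Continuous (yCoord : (Fin (m * k + n) → ℂ) → Fin (m + n) → ℂ) :=
  (yCLM m k n).continuous

theorem continuous_param : Continuous (param : (Fin (m + n) → ℂ) → Fin (m * k + n) → ℂ) := by
  refine continuous_pi fun r => ?_
  rcases index_cases r with ⟨i, a, rfl⟩ | ⟨j, rfl⟩
  · simp only [param_blk]; exact (continuous_apply _).div_const _
  · simp only [param_free]; exact continuous_apply _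

theorem tendsto_param (hk : 2 ≤ k) {x : Fin (m * k + n) → ℂ} (hx : x ∈ stratum m k n) :
    Tendsto (param : (Fin (m + n) → ℂ) → Fin (m * k + n) → ℂ) (𝓝 (yCoord x)) (𝓝 x) := by
  have := (continuous_param (m := m) (k := k) (n := n)).tendsto (yCoord x)
  rwa [param_yCoord hk hx] at this

variable {x₀ : Fin (m * k + n) → ℂ}

theorem IsGeneric.apply_blk_eq_iff (hx₀ : IsGeneric (stratum m k n) x₀) (i : Fin m) (a : Fin k)
    (s : Fin (m * k + n)) : x₀ (blk i a) = x₀ s ↔ ∃ b, s = blk i b :=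
  ⟨fun h => (coincide_blk i a s).1 (hx₀.2 _ _ h), fun h => (coincide_blk i a s).2 h _ hx₀.1⟩

theorem IsGeneric.apply_free_eq_iff (hx₀ : IsGeneric (stratum m k n) x₀) (j : Fin n)
    (s : Fin (m * k + n)) : x₀ (free j) = x₀ s ↔ s = free j :=
  ⟨fun h => (coincide_free j s).1 (hx₀.2 _ _ h), fun h => (coincide_free j s).2 h _ hx₀.1⟩

/-- Near a generic point of the stratum, the union of its images is the stratum itself. -/
theorem eventually_mem_stratum (hx₀ : IsGeneric (stratum m k n) x₀) :
    ∀ᶠ x in 𝓝 x₀, x ∈ saturation (stratum m k n) → x ∈ stratum m k n := by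
  have E : ∀ᶠ x in 𝓝 x₀, ∀ r s, x₀ r ≠ x₀ s → x r ≠ x s :=
    eventually_all.2 fun r => eventually_all.2 fun s => eventually_imp_distrib_left.2 fun h =>
      ((continuous_apply r).continuousAt.ne_iff_eventually_ne
        (continuous_apply s).continuousAt).1 h
  filter_upwards [E] with x hx
  rintro ⟨w, hw⟩
  -- Count the coincidences between coordinates. Near x₀ no new ones appear; a point of the
  -- saturation has at least as many as x₀, since permutations preserve the number and the
  -- coincidences of x₀ hold on all of π. Hence `x` and x₀ have the same ones.
  let T : (Fin (m * k + n) → ℂ) → Finset (Fin (m * k + n) × Fin (m * k + n)) := fun z =>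
    Finset.univ.filter fun q => z q.1 = z q.2
  have hT : ∀ z q, q ∈ T z ↔ z q.1 = z q.2 := fun z q => by simp [T]
  have h1 : (T (x ∘ w)).card = (T x).card := by
    refine Finset.card_bij (fun q _ => (w q.1, w q.2)) ?_ ?_ ?_
    · intro q hq
      exact (hT x _).2 ((hT (x ∘ w) q).1 hq)
    · rintro ⟨a, b⟩ _ ⟨a', b'⟩ _ h
      simpa using h
    · rintro ⟨a, b⟩ hq
      refine ⟨(w.symm a, w.symm b), (hT _ _).2 ?_, by simp⟩
      simpa using (hT _ _).1 hq
  have h2 : T x ⊆ T x₀ := fun q hq => (hT _ _).2 (by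
    by_contra h
    exact hx _ _ h ((hT _ _).1 hq))
  have h3 : T x₀ ⊆ T (x ∘ w) := fun q hq => (hT _ _).2 (hx₀.2 _ _ ((hT _ _).1 hq) _ hw)
  have h4 : T x = T x₀ := Finset.eq_of_subset_of_card_le h2 (h1 ▸ Finset.card_le_card h3)
  intro i a b
  have h5 : (blk i a, blk i b) ∈ T x₀ := (hT _ _).2 (hx₀.1 i a b)
  rw [← h4] at h5
  exact (hT _ _).1 h5

/-- The orbit is finite, so a small closed ball around x₀ contains no other point of it, and the
complement of that ball is a neighbourhood of all the others. This lets germs at x₀ be modified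
independently of the rest of the orbit. -/
theorem exists_isolating_radius {I : Type*} [Fintype I] (x₀ : I → ℂ) :
    ∃ ε > 0, ∀ p ∈ orbit x₀, p ≠ x₀ → ∀ᶠ x in 𝓝 p, x ∉ Metric.ball x₀ ε := by
  classical
  have hfin : (orbit x₀ \ {x₀}).Finite := (Set.finite_range _).subset Set.sdiff_subset
  have h1 : (orbit x₀ \ {x₀})ᶜ ∈ 𝓝 x₀ := hfin.isClosed.isOpen_compl.mem_nhds (by simp)
  obtain ⟨ε, hε, hball⟩ := Metric.nhds_basis_closedBall.mem_iff.1 h1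
  refine ⟨ε, hε, fun p hp hne => ?_⟩
  have h2 : p ∈ (Metric.closedBall x₀ ε)ᶜ := fun h => hball h ⟨hp, hne⟩
  filter_upwards [Metric.isClosed_closedBall.isOpen_compl.mem_nhds h2] with x hx hx'
  exact hx (Metric.ball_subset_closedBall hx')

open Classical in
/-- The function that agrees with `g`, constant along the fibres of the coordinates `y`, near `x₀`
and with `f` near the other points of the orbit of `x₀`. -/
noncomputable def glueFun (f : AnFun (orbit x₀)) (g : AnFun {yCoord x₀}) : AnFun (orbit x₀) :=
  ⟨fun x => if x ∈ Metric.ball x₀ (exists_isolating_radius x₀).choose then g.1 (yCoord x)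
    else f.1 x, fun p hp => by
    obtain ⟨hε, h⟩ := (exists_isolating_radius x₀).choose_spec
    by_cases hpx : p = x₀
    · subst hpx
      have h1 : AnalyticAt ℂ (fun x => g.1 (yCoord x)) p :=
        AnalyticAt.fun_comp (g.2 _ rfl) ((yCLM m k n).analyticAt p)
      refine h1.congr ?_
      filter_upwards [Metric.ball_mem_nhds p hε] with x hx
      rw [if_pos hx]
    · refine (f.2 p hp).congr ?_
      filter_upwards [h p hp hpx] with x hx
      rw [if_neg hx]⟩

theorem glueFun_near (f : AnFun (orbit x₀)) (g : AnFun {yCoord x₀}) :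
    (glueFun f g).1 =ᶠ[𝓝 x₀] fun x => g.1 (yCoord x) := by
  filter_upwards [Metric.ball_mem_nhds x₀ (exists_isolating_radius x₀).choose_spec.1] with x hx
  exact if_pos hx

theorem glueFun_far (f : AnFun (orbit x₀)) (g : AnFun {yCoord x₀}) {p : Fin (m * k + n) → ℂ}
    (hp : p ∈ orbit x₀) (hne : p ≠ x₀) : (glueFun f g).1 =ᶠ[𝓝 p] f.1 := by
  filter_upwards [(exists_isolating_radius x₀).choose_spec.2 p hp hne] with x hx
  exact if_neg hx

theorem isGermOf_germAt (hk : 2 ≤ k) (hx₀ : IsGeneric (stratum m k n) x₀) (f : AnFun (orbit x₀)) :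
    IsGermOf (germAt hk hx₀ (AnGerm.mk _ _ f)) fun y => f.1 (param y) :=
  ⟨_, (AnGerm.lift_mk _ _ _ _ f).symm, EventuallyEq.rfl⟩

theorem isGermOf_germAt_perm (hk : 2 ≤ k) (hx₀ : IsGeneric (stratum m k n) x₀)
    (w : Equiv.Perm (Fin (m * k + n))) (f : AnFun (orbit x₀)) :
    IsGermOf (germAt hk hx₀ (permStratum x₀ w (AnGerm.mk _ _ f))) fun y => f.1 (param y ∘ w) := by
  rw [permStratum_mk]
  exact isGermOf_germAt hk hx₀ _

theorem permStratum_mul (u w : Equiv.Perm (Fin (m * k + n))) (a : StratumGerm m k n x₀) :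
    permStratum x₀ (u * w) a = permStratum x₀ u (permStratum x₀ w a) := by
  obtain ⟨f, rfl⟩ := AnGerm.mk_surjective _ _ a
  simp only [permStratum_mk]
  rfl

/-- A germ near the orbit of `x₀` is determined by its translates at `x₀`. -/
theorem eq_of_forall_germAt_perm (hk : 2 ≤ k) (hx₀ : IsGeneric (stratum m k n) x₀)
    {a b : StratumGerm m k n x₀}
    (h : ∀ w, germAt hk hx₀ (permStratum x₀ w a) = germAt hk hx₀ (permStratum x₀ w b)) : a = b := by
  obtain ⟨f, rfl⟩ := AnGerm.mk_surjective _ _ a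
  obtain ⟨g, rfl⟩ := AnGerm.mk_surjective _ _ b
  refine AnGerm.mk_eq_mk.2 (mem_vanishing.2 ?_)
  rintro _ ⟨w, rfl⟩
  have h1 := (isGermOf_germAt_perm hk hx₀ w f).eventuallyEq (h w ▸ isGermOf_germAt_perm hk hx₀ w g)
  have h2 : Tendsto (fun x : Fin (m * k + n) → ℂ => x ∘ ⇑w⁻¹) (𝓝 (x₀ ∘ w)) (𝓝 x₀) := by
    have h3 := (permCLM w⁻¹).continuous.tendsto (x₀ ∘ w)
    have h4 : permCLM w⁻¹ (x₀ ∘ w) = x₀ := by ext r; simp [permCLM_apply]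
    rwa [h4] at h3
  -- A point of the saturation near `x₀ ∘ w` is moved by `w⁻¹` to a point near x₀, which then lies
  -- on the stratum itself, where `param` inverts `yCoord`.
  filter_upwards [h2.eventually ((continuous_yCoord.tendsto x₀).eventually h1),
    h2.eventually (eventually_mem_stratum hx₀)] with x h3 h4 h5
  have h6 := h4 (saturation_perm _ _ _ h5)
  rw [param_yCoord hk h6] at h3
  have h7 : (x ∘ ⇑w⁻¹) ∘ ⇑w = x := by ext r; simp
  rw [h7] at h3
  exact sub_eq_zero.2 h3

/-- Every germ has a representative that is constant along the fibres of the coordinates `y` near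
`x₀`. -/
theorem exists_representative (hk : 2 ≤ k) (hx₀ : IsGeneric (stratum m k n) x₀)
    (a : StratumGerm m k n x₀) : ∃ f : AnFun (orbit x₀), AnGerm.mk _ _ f = a ∧
      f.1 =ᶠ[𝓝 x₀] fun x => f.1 (param (yCoord x)) := by
  obtain ⟨f, rfl⟩ := AnGerm.mk_surjective _ _ a
  obtain ⟨g, -, hg⟩ := isGermOf_germAt hk hx₀ f
  -- Near x₀ the function is replaced by its restriction to the stratum composed with the projection
  -- along the fibres of y. The germ is unchanged, because near x₀ the saturation is the stratum.
  refine ⟨glueFun f g, AnGerm.mk_eq_mk.2 (mem_vanishing.2 fun p hp => ?_), ?_⟩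
  · by_cases hpx : p = x₀
    · subst hpx
      filter_upwards [glueFun_near f g, (continuous_yCoord.tendsto p).eventually hg,
        eventually_mem_stratum hx₀] with x h1 h2 h3 h4
      show (glueFun f g).1 x - f.1 x = 0
      rw [h1, h2, param_yCoord hk (h3 h4), sub_self]
    · filter_upwards [glueFun_far f g hp hpx] with x h1 _
      show (glueFun f g).1 x - f.1 x = 0
      rw [h1, sub_self]
  · have h1 : Tendsto (fun x : Fin (m * k + n) → ℂ => (param (yCoord x) : Fin (m * k + n) → ℂ))
        (𝓝 x₀) (𝓝 x₀) := (tendsto_param hk hx₀.1).comp (continuous_yCoord.tendsto x₀)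
    filter_upwards [glueFun_near f g, h1.eventually (glueFun_near f g)] with x h2 h3
    rw [h2, h3, yCoord_param hk]

/-- Extension of a germ at `x₀` by zero to the other points of the orbit. -/
noncomputable def extGerm (x₀ : Fin (m * k + n) → ℂ) :
    AnGerm Set.univ {yCoord x₀} →ₗ[ℂ] StratumGerm m k n x₀ :=
  AnGerm.lift (glueFun 0)
    (fun f g => mem_vanishing.2 fun p _ => Eventually.of_forall fun x _ => by
      by_cases h : x ∈ Metric.ball x₀ (exists_isolating_radius x₀).choose
      · show (glueFun 0 (f + g)).1 x - ((glueFun 0 f).1 x + (glueFun 0 g).1 x) = 0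
        simp only [glueFun, if_pos h]
        exact sub_self _
      · show (glueFun 0 (f + g)).1 x - ((glueFun 0 f).1 x + (glueFun 0 g).1 x) = 0
        simp only [glueFun, if_neg h]
        simp)
    (fun c f => mem_vanishing.2 fun p _ => Eventually.of_forall fun x _ => by
      by_cases h : x ∈ Metric.ball x₀ (exists_isolating_radius x₀).choose
      · show (glueFun 0 (c • f)).1 x - c • (glueFun 0 f).1 x = 0
        simp only [glueFun, if_pos h]
        exact sub_self _
      · show (glueFun 0 (c • f)).1 x - c • (glueFun 0 f).1 x = 0
        simp only [glueFun, if_neg h]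
        simp)
    (fun f hf => mem_vanishing.2 fun p hp => by
      by_cases hpx : p = x₀
      · subst hpx
        filter_upwards [glueFun_near 0 f,
          (continuous_yCoord.tendsto p).eventually (mem_vanishing.1 hf _ rfl)] with x h1 h2 _
        rw [h1, h2 trivial]
      · filter_upwards [glueFun_far 0 f hp hpx] with x h1 _
        rw [h1]; rfl)

/-- By genericity the level sets of x₀ are exactly the blocks and the single free indices. Adjacent
transpositions connect each block, and a group generated by transpositions contains every finitely
supported permutation that preserves its orbits. -/
theorem mem_parabolic_iff (hx₀ : IsGeneric (stratum m k n) x₀) (w : Equiv.Perm (Fin (m * k + n))) :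
    w ∈ parabolic m k n ↔ x₀ ∘ w = x₀ := by
  constructor
  · intro hw
    obtain ⟨⟨σ, hσ⟩, hf⟩ := parabolic_inv_apply (inv_mem hw)
    rw [inv_inv] at hσ hf
    ext r
    rcases index_cases r with ⟨i, a, rfl⟩ | ⟨j, rfl⟩
    · simp only [Function.comp_apply, hσ]; exact hx₀.1 _ _ _
    · simp only [Function.comp_apply, hf]
  · intro hw
    have hw' : ∀ r, x₀ (w r) = x₀ r := fun r => congrFun hw r
    have hswap : ∀ f ∈ {w : Equiv.Perm (Fin (m * k + n)) | ∃ (i : Fin m) (a b : Fin k),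
        (b : ℕ) = a + 1 ∧ w = Equiv.swap (blk i a) (blk i b)}, f.IsSwap := by
      rintro _ ⟨i, a, b, hab, rfl⟩
      refine ⟨_, _, fun h => ?_, rfl⟩
      have := (blk_inj.1 h).2
      omega
    have horb : ∀ (i : Fin m) (b : ℕ) (hb : b < k) (h0 : 0 < k),
        (blk i ⟨b, hb⟩ : Fin (m * k + n)) ∈ MulAction.orbit (parabolic m k n) (blk i ⟨0, h0⟩ : Fin (m * k + n)) := by
      intro i b
      induction b with
      | zero => intro _ _; exact MulAction.mem_orbit_self _
      | succ b ih =>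
        intro hb h0
        have h1 := ih (by omega) h0
        have h2 : Equiv.swap (blk i ⟨b, by omega⟩) (blk i ⟨b + 1, hb⟩) ∈ parabolic m k n :=
          Subgroup.subset_closure ⟨i, ⟨b, by omega⟩, ⟨b + 1, hb⟩, rfl, rfl⟩
        have h3 := MulAction.mem_orbit_of_mem_orbit (⟨_, h2⟩ : parabolic m k n) h1
        simpa [Subgroup.smul_def] using h3
    refine (mem_closure_isSwap hswap).2 ⟨Set.toFinite _, fun r => ?_⟩
    rcases index_cases r with ⟨i, a, rfl⟩ | ⟨j, rfl⟩
    · obtain ⟨b, hb⟩ := (hx₀.apply_blk_eq_iff i a _).1 (hw' _).symm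
      rw [hb]
      have h0 : 0 < k := a.pos
      have h1 := horb i b b.2 h0
      have h2 := horb i a a.2 h0
      rw [← MulAction.orbit_eq_iff] at h1 h2
      rw [← MulAction.orbit_eq_iff]
      exact h1.trans h2.symm
    · rw [(hx₀.apply_free_eq_iff j _).1 (hw' _).symm]
      exact MulAction.mem_orbit_self _

/-- W₀ fixes π pointwise, not only x₀. -/
theorem germAt_perm_of_mem (hk : 2 ≤ k) (hx₀ : IsGeneric (stratum m k n) x₀)
    {w : Equiv.Perm (Fin (m * k + n))} (hw : w ∈ parabolic m k n) (a : StratumGerm m k n x₀) :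
    germAt hk hx₀ (permStratum x₀ w a) = germAt hk hx₀ a := by
  obtain ⟨f, rfl⟩ := AnGerm.mk_surjective _ _ a
  have h1 : ∀ y : Fin (m + n) → ℂ, (param y : Fin (m * k + n) → ℂ) ∘ w = param y := by
    intro y
    ext r
    exact hx₀.2 _ _ (congrFun ((mem_parabolic_iff hx₀ w).1 hw) r) _ (param_mem y)
  refine IsGermOf.eq (isGermOf_germAt_perm hk hx₀ w f) ?_
  simp only [h1]
  exact isGermOf_germAt hk hx₀ f

theorem germAt_extGerm (hk : 2 ≤ k) (hx₀ : IsGeneric (stratum m k n) x₀)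
    (g : AnGerm Set.univ {yCoord x₀}) : germAt hk hx₀ (extGerm x₀ g) = g := by
  obtain ⟨g, rfl⟩ := AnGerm.mk_surjective _ _ g
  have h1 : extGerm x₀ (AnGerm.mk _ _ g) = AnGerm.mk _ _ (glueFun 0 g) := AnGerm.lift_mk ..
  rw [h1]
  refine ((isGermOf_germAt hk hx₀ _).congr ?_).eq (IsGermOf.mk g)
  filter_upwards [(tendsto_param hk hx₀.1).eventually (glueFun_near 0 g)] with y hy
  rw [hy, yCoord_param hk]

/-- Such a permutation moves x₀ to a different point of the orbit, where the extension is zero. -/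
theorem germAt_perm_extGerm_of_notMem (hk : 2 ≤ k) (hx₀ : IsGeneric (stratum m k n) x₀)
    {w : Equiv.Perm (Fin (m * k + n))} (hw : w ∉ parabolic m k n)
    (g : AnGerm Set.univ {yCoord x₀}) : germAt hk hx₀ (permStratum x₀ w (extGerm x₀ g)) = 0 := by
  obtain ⟨g, rfl⟩ := AnGerm.mk_surjective _ _ g
  have h1 : extGerm x₀ (AnGerm.mk _ _ g) = AnGerm.mk _ _ (glueFun 0 g) := AnGerm.lift_mk ..
  rw [h1]
  refine ((isGermOf_germAt_perm hk hx₀ w _).congr ?_).eq IsGermOf.zero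
  have h2 : Tendsto (fun y : Fin (m + n) → ℂ => (param y : Fin (m * k + n) → ℂ) ∘ w)
      (𝓝 (yCoord x₀)) (𝓝 (x₀ ∘ w)) :=
    ((permCLM w).continuous.tendsto x₀).comp (tendsto_param hk hx₀.1)
  filter_upwards [h2.eventually (glueFun_far 0 g ⟨w, rfl⟩
    fun h => hw ((mem_parabolic_iff hx₀ w).2 h))] with y hy
  rw [hy]; rfl

end StratumGerms

/-! ### The scalar operator in the coordinates y. -/

section ScalarFormula

variable {m k n : ℕ}

theorem sum_index {M : Type*} [AddCommMonoid M] (g : Fin (m * k + n) → M) :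
    ∑ r, g r = ∑ i : Fin m, ∑ a : Fin k, g (blk i a) + ∑ j : Fin n, g (free j) := by
  rw [Fin.sum_univ_add, ← finProdFinEquiv.sum_comp, Fintype.sum_prod_type]
  rfl

theorem sum_sum_eq_two_mul_sum_Ioi {l : ℕ} {A : Fin l → Fin l → ℂ} (hsymm : ∀ i j, A i j = A j i)
    (hdiag : ∀ i, A i i = 0) : ∑ i, ∑ j, A i j = 2 * ∑ i, ∑ j ∈ Finset.Ioi i, A i j := by
  have h := Finset.sum_sum_Ioi_add_eq_sum_sum_off_diag A
  have h1 : ∀ i, ∑ j ∈ {i}ᶜ, A j i = ∑ j, A i j := fun i => by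
    rw [← Finset.sum_compl_add_sum {i} (A i), Finset.sum_singleton, hdiag, add_zero]
    exact Finset.sum_congr rfl fun j _ => hsymm j i
  simp only [h1] at h
  rw [← h, Finset.mul_sum]
  refine Finset.sum_congr rfl fun i _ => ?_
  rw [Finset.mul_sum]
  refine Finset.sum_congr rfl fun j _ => ?_
  rw [hsymm j i, two_mul]

/-- Sorts the ordered pairs by type; each unordered pair is counted twice, which is the source of
the factor 2 in every interaction term of `H_2`. -/
theorem sum_index_pairs {T : Fin (m * k + n) → Fin (m * k + n) → ℂ} (hsymm : ∀ r s, T r s = T s r)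
    (hb : ∀ i a b, T (blk i a) (blk i b) = 0) (hf : ∀ j, T (free j) (free j) = 0) :
    ∑ r, ∑ s, T r s = 2 * (∑ i : Fin n, ∑ j ∈ Finset.Ioi i, T (free i) (free j)
      + ∑ i : Fin m, ∑ j : Fin n, ∑ a : Fin k, T (blk i a) (free j)
      + ∑ i : Fin m, ∑ j ∈ Finset.Ioi i, ∑ a : Fin k, ∑ b : Fin k, T (blk i a) (blk j b)) := by
  have h1 := sum_sum_eq_two_mul_sum_Ioi (A := fun i j : Fin n => T (free i) (free j))
    (fun i j => hsymm _ _) hf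
  have h2 := sum_sum_eq_two_mul_sum_Ioi
    (A := fun i j : Fin m => ∑ a : Fin k, ∑ b : Fin k, T (blk i a) (blk j b))
    (fun i j => by
      rw [Finset.sum_comm]
      exact Finset.sum_congr rfl fun a _ => Finset.sum_congr rfl fun b _ => hsymm _ _)
    (fun i => by simp only [hb, Finset.sum_const_zero])
  have h3 : ∑ i : Fin m, ∑ a : Fin k, ∑ j : Fin n, T (blk i a) (free j)
      = ∑ i : Fin m, ∑ j : Fin n, ∑ a : Fin k, T (blk i a) (free j) :=
    Finset.sum_congr rfl fun i _ => Finset.sum_comm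
  have h4 : ∑ j : Fin n, ∑ i : Fin m, ∑ a : Fin k, T (free j) (blk i a)
      = ∑ i : Fin m, ∑ j : Fin n, ∑ a : Fin k, T (blk i a) (free j) := by
    rw [Finset.sum_comm]
    exact Finset.sum_congr rfl fun i _ => Finset.sum_congr rfl fun j _ =>
      Finset.sum_congr rfl fun a _ => hsymm _ _
  have h5 : ∑ i : Fin m, ∑ a : Fin k, ∑ j : Fin m, ∑ b : Fin k, T (blk i a) (blk j b)
      = ∑ i : Fin m, ∑ j : Fin m, ∑ a : Fin k, ∑ b : Fin k, T (blk i a) (blk j b) :=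
    Finset.sum_congr rfl fun i _ => Finset.sum_comm
  simp only [sum_index (m := m) (k := k) (n := n), Finset.sum_add_distrib]
  rw [h1, h3, h4, h5, h2]
  ring

/-- On functions of y, a derivative in a block coordinate is ∂_{y_i}/√k. The normalization of y_i is
the one for which the `k` second derivatives of a block add up to ∂_{y_i}². -/
theorem yCoord_single_blk (i : Fin m) (a : Fin k) :
    yCoord (Pi.single (blk i a) 1 : Fin (m * k + n) → ℂ)
      = (Real.sqrt k : ℂ)⁻¹ • (Pi.single (Fin.castAdd n i) 1 : Fin (m + n) → ℂ) := by
  ext r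
  refine Fin.addCases (fun i' => ?_) (fun j => ?_) r
  · by_cases h : i' = i
    · subst h
      simp [yCoord, Pi.single_apply, blk_inj, Finset.filter_eq']
    · simp [yCoord, Pi.single_apply, blk_inj, h]
  · have h : Fin.natAdd m j ≠ Fin.castAdd n i := fun h => by
      have := congrArg Fin.val h
      simp only [Fin.val_natAdd, Fin.val_castAdd] at this
      omega
    simp [yCoord, Pi.single_apply, (blk_ne_free i a j).symm, h]

theorem yCoord_single_free (j : Fin n) :
    yCoord (Pi.single (free j) 1 : Fin (m * k + n) → ℂ)
      = (Pi.single (Fin.natAdd m j) 1 : Fin (m + n) → ℂ) := by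
  ext r
  refine Fin.addCases (fun i' => ?_) (fun j' => ?_) r
  · have h : Fin.castAdd n i' ≠ Fin.natAdd m j := fun h => by
      have := congrArg Fin.val h
      simp only [Fin.val_natAdd, Fin.val_castAdd] at this
      omega
    simp [yCoord, Pi.single_apply, blk_ne_free, h]
  · simp [yCoord, Pi.single_apply, free_inj]

variable {x₀ : Fin (m * k + n) → ℂ}

/-- Chain rule for the linear map `yCoord`. Since the conclusion holds on a neighbourhood and has
the shape of the hypothesis, it can be applied again to obtain second derivatives. -/
theorem fderiv_comp_yCoord {f : (Fin (m * k + n) → ℂ) → ℂ} {g : (Fin (m + n) → ℂ) → ℂ}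
    (hg : AnalyticAt ℂ g (yCoord x₀)) (hfg : f =ᶠ[𝓝 x₀] fun x => g (yCoord x))
    (v : Fin (m * k + n) → ℂ) :
    (fun x => fderiv ℂ f x v) =ᶠ[𝓝 x₀] fun x => fderiv ℂ g (yCoord x) (yCoord v) := by
  filter_upwards [hfg.eventuallyEq_nhds,
    (continuous_yCoord.tendsto x₀).eventually hg.eventually_analyticAt] with x h1 h2
  have h3 : HasFDerivAt (fun x => g (yCoord x)) ((fderiv ℂ g (yCoord x)).comp (yCLM m k n)) x :=
    HasFDerivAt.comp x (g := g) (f := yCLM m k n) h2.differentiableAt.hasFDerivAt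
      (yCLM m k n).hasFDerivAt
  rw [h1.fderiv_eq, h3.fderiv]
  rfl

theorem sqrt_ne_zero_of_two_le (hk : 2 ≤ k) : (Real.sqrt k : ℂ) ≠ 0 := by
  have h : (k : ℂ) ≠ 0 := Nat.cast_ne_zero.2 (by omega)
  intro h0
  apply h
  rw [← sqrt_mul_sqrt, h0, zero_mul]

theorem yCoord_castAdd_eq (hk : 2 ≤ k) (hx₀ : x₀ ∈ stratum m k n) (i : Fin m) (a : Fin k) :
    yCoord x₀ (Fin.castAdd n i) = (Real.sqrt k : ℂ) * x₀ (blk i a) := by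
  have h := congrFun (param_yCoord hk hx₀) (blk i a)
  rw [param_blk] at h
  rw [← h, mul_div_cancel₀ _ (sqrt_ne_zero_of_two_le hk)]

theorem yCoord_natAdd_eq (j : Fin n) :
    yCoord x₀ (Fin.natAdd m j) = x₀ (free j) := by
  simp [yCoord]

/-- Genericity separates different blocks and free coordinates. This and the next two statements
make the denominators of `H_2` invertible germs at y₀. -/
theorem yCoord_castAdd_ne (hk : 2 ≤ k) (hx₀ : IsGeneric (stratum m k n) x₀) {i j : Fin m}
    (hij : i ≠ j) : yCoord x₀ (Fin.castAdd n i) - yCoord x₀ (Fin.castAdd n j) ≠ 0 := by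
  have a : Fin k := ⟨0, by omega⟩
  rw [yCoord_castAdd_eq hk hx₀.1 i a, yCoord_castAdd_eq hk hx₀.1 j a, ← mul_sub]
  refine mul_ne_zero (sqrt_ne_zero_of_two_le hk) (sub_ne_zero.2 fun h => ?_)
  obtain ⟨b, hb⟩ := (hx₀.apply_blk_eq_iff i a _).1 h
  exact hij (blk_inj.1 hb).1.symm

theorem yCoord_castAdd_natAdd_ne (hk : 2 ≤ k) (hx₀ : IsGeneric (stratum m k n) x₀) (i : Fin m)
    (j : Fin n) :
    yCoord x₀ (Fin.castAdd n i) - (Real.sqrt k : ℂ) * yCoord x₀ (Fin.natAdd m j) ≠ 0 := by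
  have a : Fin k := ⟨0, by omega⟩
  rw [yCoord_castAdd_eq hk hx₀.1 i a, yCoord_natAdd_eq, ← mul_sub]
  refine mul_ne_zero (sqrt_ne_zero_of_two_le hk) (sub_ne_zero.2 fun h => ?_)
  obtain ⟨b, hb⟩ := (hx₀.apply_blk_eq_iff i a _).1 h
  exact blk_ne_free _ _ _ hb.symm

theorem yCoord_natAdd_ne (hx₀ : IsGeneric (stratum m k n) x₀) {i j : Fin n} (hij : i ≠ j) :
    yCoord x₀ (Fin.natAdd m i) - yCoord x₀ (Fin.natAdd m j) ≠ 0 := by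
  rw [yCoord_natAdd_eq, yCoord_natAdd_eq]
  refine sub_ne_zero.2 fun h => hij ?_
  exact (free_inj.1 ((hx₀.apply_free_eq_iff i _).1 h)).symm

theorem isGermOf_germAt_dunklLaplacian (hk : 2 ≤ k) (hx₀ : IsGeneric (stratum m k n) x₀)
    (f : AnFun (orbit x₀)) :
    IsGermOf (germAt hk hx₀ (dunklLaplacian hk hx₀ (AnGerm.mk _ _ f)))
      fun y => ∑ r, dunklFun (1 / (k : ℂ)) r (dunklFun (1 / (k : ℂ)) r f.1) (param y) := by
  simp only [dunklLaplacian, LinearMap.sum_apply, LinearMap.comp_apply, map_sum]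
  refine IsGermOf.sum fun r _ => ?_
  rw [dunkl_mk, dunkl_mk]
  exact isGermOf_germAt hk hx₀ _

/-- The sum of the squares of the Dunkl operators on the stratum, applied to a function that is
constant along the fibres of the coordinates `y`. -/
theorem sum_dunklFun_dunklFun_param (hk : 2 ≤ k) (hx₀ : IsGeneric (stratum m k n) x₀)
    {f : (Fin (m * k + n) → ℂ) → ℂ} (hf : AnalyticOnNhd ℂ f (orbit x₀))
    {g : (Fin (m + n) → ℂ) → ℂ} (hg : AnalyticAt ℂ g (yCoord x₀))
    (hfg : f =ᶠ[𝓝 x₀] fun x => g (yCoord x)) :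
    ∀ᶠ y in 𝓝 (yCoord x₀),
      ∑ r, dunklFun (1 / (k : ℂ)) r (dunklFun (1 / (k : ℂ)) r f) (param y)
      = ∑ i, fderiv ℂ (fun z => fderiv ℂ g z (Pi.single i 1)) y (Pi.single i 1)
        + ∑ i : Fin n, ∑ j ∈ Finset.Ioi i, 2 * (k * (y (Fin.natAdd m i) - y (Fin.natAdd m j)) ^ 2)⁻¹
          * (g y - f (param y ∘ Equiv.swap (free i) (free j)))
        + ∑ i : Fin m, ∑ j : Fin n,
          2 * ((y (Fin.castAdd n i) - (Real.sqrt k : ℂ) * y (Fin.natAdd m j)) ^ 2)⁻¹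
          * (k * g y - ∑ a, f (param y ∘ Equiv.swap (blk i a) (free j)))
        + ∑ i : Fin m, ∑ j ∈ Finset.Ioi i,
          2 * ((y (Fin.castAdd n i) - y (Fin.castAdd n j)) ^ 2)⁻¹
          * (k ^ 2 * g y - ∑ a, ∑ b, f (param y ∘ Equiv.swap (blk i a) (blk j b)))
        - ∑ i : Fin n, ∑ j ∈ Finset.Ioi i, 2 * (k * (y (Fin.natAdd m i) - y (Fin.natAdd m j)))⁻¹
          * (fderiv ℂ g y (Pi.single (Fin.natAdd m i) 1)
            - fderiv ℂ g y (Pi.single (Fin.natAdd m j) 1))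
        - ∑ i : Fin m, ∑ j : Fin n,
          2 * (y (Fin.castAdd n i) - (Real.sqrt k : ℂ) * y (Fin.natAdd m j))⁻¹
          * (fderiv ℂ g y (Pi.single (Fin.castAdd n i) 1)
            - (Real.sqrt k : ℂ) * fderiv ℂ g y (Pi.single (Fin.natAdd m j) 1))
        - ∑ i : Fin m, ∑ j ∈ Finset.Ioi i,
          2 * k * (y (Fin.castAdd n i) - y (Fin.castAdd n j))⁻¹
          * (fderiv ℂ g y (Pi.single (Fin.castAdd n i) 1)
            - fderiv ℂ g y (Pi.single (Fin.castAdd n j) 1)) := by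
  have hk0 : (k : ℂ) ≠ 0 := Nat.cast_ne_zero.2 (by omega)
  have hs0 := sqrt_ne_zero_of_two_le hk
  have hss := sqrt_mul_sqrt k
  have hd1 : ∀ v, (fun x => fderiv ℂ f x v) =ᶠ[𝓝 x₀]
      fun x => fderiv ℂ g (yCoord x) (yCoord v) := fderiv_comp_yCoord hg hfg
  have hd2 : ∀ v, (fun x => fderiv ℂ (fun z => fderiv ℂ f z v) x v) =ᶠ[𝓝 x₀]
      fun x => fderiv ℂ (fun z => fderiv ℂ g z (yCoord v)) (yCoord x) (yCoord v) := fun v =>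
    fderiv_comp_yCoord (analyticAt_fderiv_apply hg (yCoord v)) (hd1 v) v
  have hblock : ∀ r s, x₀ r = x₀ s → r = s ∨ ∃ i a b, r = blk i a ∧ s = blk i b := by
    intro r s h
    rcases index_cases r with ⟨i, a, rfl⟩ | ⟨j, rfl⟩
    · obtain ⟨b, rfl⟩ := (hx₀.apply_blk_eq_iff i a s).1 h
      exact Or.inr ⟨i, a, b, rfl, rfl⟩
    · exact Or.inl ((hx₀.apply_free_eq_iff j s).1 h).symm
  have hder : ∀ r s, x₀ r = x₀ s →
      ∀ᶠ x in 𝓝 x₀, fderiv ℂ f x (Pi.single r 1) = fderiv ℂ f x (Pi.single s 1) := by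
    intro r s h
    rcases hblock r s h with rfl | ⟨i, a, b, rfl, rfl⟩
    · exact Eventually.of_forall fun _ => rfl
    · filter_upwards [hd1 (Pi.single (blk i a) 1), hd1 (Pi.single (blk i b) 1)] with x h1 h2
      rw [h1, h2, yCoord_single_blk, yCoord_single_blk]
  have hinv : ∀ r s, x₀ r = x₀ s → ∀ᶠ x in 𝓝 x₀, f (x ∘ Equiv.swap r s) = f x := by
    intro r s h
    have h1 : Tendsto (fun x : Fin (m * k + n) → ℂ => x ∘ Equiv.swap r s) (𝓝 x₀) (𝓝 x₀) := by
      have h2 := (permCLM (Equiv.swap r s)).continuous.tendsto x₀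
      have h3 : permCLM (Equiv.swap r s) x₀ = x₀ := by
        rw [permCLM_apply, comp_swap_eq, h]; simp
      rwa [h3] at h2
    -- The swap moves `x` by a multiple of e_r − e_s, which `yCoord` kills when `r` and `s` are in
    -- one block.
    have h4 : ∀ x : Fin (m * k + n) → ℂ, yCoord (x ∘ Equiv.swap r s) = yCoord x := by
      intro x
      rw [comp_swap_eq, ← yCLM_apply, ← yCLM_apply, map_sub, map_smul, map_sub, yCLM_apply,
        yCLM_apply, yCLM_apply]
      rcases hblock r s h with rfl | ⟨i, a, b, rfl, rfl⟩
      · simp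
      · rw [yCoord_single_blk, yCoord_single_blk]; simp
    filter_upwards [hfg, h1.eventually hfg] with x h5 h6
    rw [h5, h6, h4]
  have ht := tendsto_param hk hx₀.1
  have hd1' : ∀ᶠ x in 𝓝 x₀, ∀ r, fderiv ℂ f x (Pi.single r 1)
      = fderiv ℂ g (yCoord x) (yCoord (Pi.single r 1)) := eventually_all.2 fun r => hd1 _
  have hd2' : ∀ᶠ x in 𝓝 x₀, ∀ r,
      fderiv ℂ (fun z => fderiv ℂ f z (Pi.single r 1)) x (Pi.single r 1)
      = fderiv ℂ (fun z => fderiv ℂ g z (yCoord (Pi.single r 1))) (yCoord x)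
        (yCoord (Pi.single r 1)) := eventually_all.2 fun r => hd2 _
  filter_upwards [ht.eventually (sum_dunklFun_dunklFun_near (1 / (k : ℂ)) hf hinv hder),
    ht.eventually hfg, ht.eventually hd1', ht.eventually hd2', hg.eventually_analyticAt]
    with y h1 h2 h3 h4 h5
  simp only [yCoord_param hk] at h2 h3 h4
  have hb : ∀ i a, fderiv ℂ f (param y) (Pi.single (blk i a) 1)
      = (Real.sqrt k : ℂ)⁻¹ * fderiv ℂ g y (Pi.single (Fin.castAdd n i) 1) := fun i a => by
    rw [h3, yCoord_single_blk, map_smul, smul_eq_mul]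
  have hfr : ∀ j, fderiv ℂ f (param y) (Pi.single (free j) 1)
      = fderiv ℂ g y (Pi.single (Fin.natAdd m j) 1) := fun j => by
    rw [h3, yCoord_single_free]
  have hlap : ∑ r, fderiv ℂ (fun z => fderiv ℂ f z (Pi.single r 1)) (param y) (Pi.single r 1)
      = ∑ i, fderiv ℂ (fun z => fderiv ℂ g z (Pi.single i 1)) y (Pi.single i 1) := by
    rw [sum_index, Fin.sum_univ_add]
    congr 1
    · refine Finset.sum_congr rfl fun i _ => ?_
      have h6 : ∀ a, fderiv ℂ (fun z => fderiv ℂ f z (Pi.single (blk i a) 1)) (param y)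
          (Pi.single (blk i a) 1) = (k : ℂ)⁻¹ * fderiv ℂ (fun z => fderiv ℂ g z
            (Pi.single (Fin.castAdd n i) 1)) y (Pi.single (Fin.castAdd n i) 1) := by
        intro a
        rw [h4, yCoord_single_blk, map_smul]
        simp only [map_smul, smul_eq_mul]
        rw [fderiv_const_mul (analyticAt_fderiv_apply h5 _).differentiableAt]
        rw [smul_apply, smul_eq_mul, ← mul_assoc, ← mul_inv, hss]
      simp only [h6, Finset.sum_const, Finset.card_univ, Fintype.card_fin, nsmul_eq_mul]
      rw [mul_inv_cancel_left₀ hk0]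
    · refine Finset.sum_congr rfl fun j _ => ?_
      rw [h4, yCoord_single_free]
  rw [h1, hlap]
  -- The condition `x₀ r = x₀ s` singles out the diagonal and the pairs inside a block. The factor 2
  -- from the grouping and the parameter 1/k combine to the 2/k in `e1`–`e6`.
  rw [sum_index_pairs (T := fun r s => if x₀ r = x₀ s then 0 else
      (fderiv ℂ f (param y) (Pi.single r 1) - fderiv ℂ f (param y) (Pi.single s 1))
        / ((param y : Fin (m * k + n) → ℂ) r - (param y : Fin (m * k + n) → ℂ) s)),
    sum_index_pairs (T := fun r s => if x₀ r = x₀ s then 0 else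
      (f (param y) - f (param y ∘ Equiv.swap r s))
        / ((param y : Fin (m * k + n) → ℂ) r - (param y : Fin (m * k + n) → ℂ) s) ^ 2)]
  rotate_left
  · intro r s
    simp only [eq_comm (a := x₀ r), Equiv.swap_comm r s]
    congr 2
    ring
  · intro i a b
    simp [hx₀.1 i a b]
  · intro j
    simp
  · intro r s
    simp only [eq_comm (a := x₀ r)]
    congr 1
    rw [← neg_div_neg_eq, neg_sub, neg_sub]
  · intro i a b
    simp [hx₀.1 i a b]
  · intro j
    simp
  have hFF : ∀ i : Fin n, ∀ j ∈ Finset.Ioi i, x₀ (free i) ≠ x₀ (free j) := fun i j hj h =>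
    (Finset.mem_Ioi.1 hj).ne' (free_inj.1 ((hx₀.apply_free_eq_iff i _).1 h))
  have hBF : ∀ (i : Fin m) (a : Fin k) (j : Fin n), x₀ (blk i a) ≠ x₀ (free j) := fun i a j h => by
    obtain ⟨b, hb⟩ := (hx₀.apply_blk_eq_iff i a _).1 h
    exact blk_ne_free _ _ _ hb.symm
  have hBB : ∀ i : Fin m, ∀ j ∈ Finset.Ioi i, ∀ a b : Fin k, x₀ (blk i a) ≠ x₀ (blk j b) :=
    fun i j hj a b h => by
      obtain ⟨b, hb⟩ := (hx₀.apply_blk_eq_iff i a _).1 h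
      exact (Finset.mem_Ioi.1 hj).ne' (blk_inj.1 hb).1
  -- On π a block–free difference is (y_i − √k y_j)/√k and a block–block difference is (y_i −
  -- y_j)/√k. A first-order term is repeated `k` times for block–free pairs and k² times for
  -- block–block pairs. With 2/k this gives the coefficients 2 and 2k there, and 2/k for free pairs.
  have e1 : ∀ i : Fin n, ∀ j ∈ Finset.Ioi i, 2 * (k * (y (Fin.natAdd m i) - y (Fin.natAdd m j)))⁻¹
          * (fderiv ℂ g y (Pi.single (Fin.natAdd m i) 1)
            - fderiv ℂ g y (Pi.single (Fin.natAdd m j) 1))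
      = 2 / k * (if x₀ (free i) = x₀ (free j) then 0 else
        (fderiv ℂ f (param y) (Pi.single (free i) 1) - fderiv ℂ f (param y) (Pi.single (free j) 1))
        / ((param y : Fin (m * k + n) → ℂ) (free i) - (param y : Fin (m * k + n) → ℂ) (free j))) := by
    intro i j hj
    rw [if_neg (hFF i j hj), hfr, hfr, param_free, param_free, mul_inv]
    ring
  have e2 : ∀ (i : Fin m) (j : Fin n),
          2 * (y (Fin.castAdd n i) - (Real.sqrt k : ℂ) * y (Fin.natAdd m j))⁻¹
          * (fderiv ℂ g y (Pi.single (Fin.castAdd n i) 1)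
            - (Real.sqrt k : ℂ) * fderiv ℂ g y (Pi.single (Fin.natAdd m j) 1))
      = 2 / k * ∑ a : Fin k, (if x₀ (blk i a) = x₀ (free j) then 0 else
        (fderiv ℂ f (param y) (Pi.single (blk i a) 1) - fderiv ℂ f (param y) (Pi.single (free j) 1))
        / ((param y : Fin (m * k + n) → ℂ) (blk i a) - (param y : Fin (m * k + n) → ℂ) (free j))) := by
    intro i j
    have h6 : y (Fin.castAdd n i) / (Real.sqrt k : ℂ) - y (Fin.natAdd m j)
      = (y (Fin.castAdd n i) - (Real.sqrt k : ℂ) * y (Fin.natAdd m j)) * (Real.sqrt k : ℂ)⁻¹ := by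
      field_simp
    simp only [if_neg (hBF i _ j), hfr, hb, param_blk, param_free, Finset.sum_const,
      Finset.card_univ, Fintype.card_fin, nsmul_eq_mul, h6]
    rw [div_eq_mul_inv _ (_ * _), mul_inv, inv_inv]
    field_simp
  have e3 : ∀ i : Fin m, ∀ j ∈ Finset.Ioi i,
          2 * k * (y (Fin.castAdd n i) - y (Fin.castAdd n j))⁻¹
          * (fderiv ℂ g y (Pi.single (Fin.castAdd n i) 1)
            - fderiv ℂ g y (Pi.single (Fin.castAdd n j) 1))
      = 2 / k * ∑ a : Fin k, ∑ b : Fin k, (if x₀ (blk i a) = x₀ (blk j b) then 0 else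
        (fderiv ℂ f (param y) (Pi.single (blk i a) 1)
          - fderiv ℂ f (param y) (Pi.single (blk j b) 1))
        / ((param y : Fin (m * k + n) → ℂ) (blk i a)
          - (param y : Fin (m * k + n) → ℂ) (blk j b))) := by
    intro i j hj
    simp only [if_neg (hBB i j hj _ _), hb, param_blk, Finset.sum_const,
      Finset.card_univ, Fintype.card_fin, nsmul_eq_mul]
    rw [← sub_div, ← mul_sub, div_eq_mul_inv _ (_ / _), inv_div]
    field_simp
  have e4 : ∀ i : Fin n, ∀ j ∈ Finset.Ioi i,
        2 * (k * (y (Fin.natAdd m i) - y (Fin.natAdd m j)) ^ 2)⁻¹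
          * (g y - f (param y ∘ Equiv.swap (free i) (free j)))
      = 2 / k * (if x₀ (free i) = x₀ (free j) then 0 else
        (f (param y) - f (param y ∘ Equiv.swap (free i) (free j)))
        / ((param y : Fin (m * k + n) → ℂ) (free i)
          - (param y : Fin (m * k + n) → ℂ) (free j)) ^ 2) := by
    intro i j hj
    rw [if_neg (hFF i j hj), param_free, param_free, mul_inv, h2]
    ring
  have e5 : ∀ (i : Fin m) (j : Fin n),
        2 * ((y (Fin.castAdd n i) - (Real.sqrt k : ℂ) * y (Fin.natAdd m j)) ^ 2)⁻¹
          * (k * g y - ∑ a, f (param y ∘ Equiv.swap (blk i a) (free j)))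
      = 2 / k * ∑ a : Fin k, (if x₀ (blk i a) = x₀ (free j) then 0 else
        (f (param y) - f (param y ∘ Equiv.swap (blk i a) (free j)))
        / ((param y : Fin (m * k + n) → ℂ) (blk i a)
          - (param y : Fin (m * k + n) → ℂ) (free j)) ^ 2) := by
    intro i j
    have h6 : y (Fin.castAdd n i) / (Real.sqrt k : ℂ) - y (Fin.natAdd m j)
      = (y (Fin.castAdd n i) - (Real.sqrt k : ℂ) * y (Fin.natAdd m j)) * (Real.sqrt k : ℂ)⁻¹ := by
      field_simp
    simp only [if_neg (hBF i _ j), param_blk, param_free, h6, h2]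
    rw [← Finset.sum_div, Finset.sum_sub_distrib, Finset.sum_const, Finset.card_univ,
      Fintype.card_fin, nsmul_eq_mul, div_eq_mul_inv _ (_ ^ 2), mul_pow, mul_inv, ← inv_pow (_)⁻¹,
      inv_inv, pow_two (Real.sqrt k : ℂ), hss]
    field_simp
  have e6 : ∀ i : Fin m, ∀ j ∈ Finset.Ioi i,
        2 * ((y (Fin.castAdd n i) - y (Fin.castAdd n j)) ^ 2)⁻¹
          * (k ^ 2 * g y - ∑ a, ∑ b, f (param y ∘ Equiv.swap (blk i a) (blk j b)))
      = 2 / k * ∑ a : Fin k, ∑ b : Fin k, (if x₀ (blk i a) = x₀ (blk j b) then 0 else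
        (f (param y) - f (param y ∘ Equiv.swap (blk i a) (blk j b)))
        / ((param y : Fin (m * k + n) → ℂ) (blk i a)
          - (param y : Fin (m * k + n) → ℂ) (blk j b)) ^ 2) := by
    intro i j hj
    simp only [if_neg (hBB i j hj _ _), param_blk, h2, ← Finset.sum_div, Finset.sum_sub_distrib,
      Finset.sum_const, Finset.card_univ, Fintype.card_fin, nsmul_eq_mul]
    rw [← sub_div, div_eq_mul_inv _ ((_ / _) ^ 2), div_pow, inv_div, pow_two (Real.sqrt k : ℂ), hss]
    field_simp
  rw [Finset.sum_congr rfl fun i _ => Finset.sum_congr rfl (e1 i),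
    Finset.sum_congr rfl fun i _ => Finset.sum_congr rfl fun j _ => e2 i j,
    Finset.sum_congr rfl fun i _ => Finset.sum_congr rfl (e3 i),
    Finset.sum_congr rfl fun i _ => Finset.sum_congr rfl (e4 i),
    Finset.sum_congr rfl fun i _ => Finset.sum_congr rfl fun j _ => e5 i j,
    Finset.sum_congr rfl fun i _ => Finset.sum_congr rfl (e6 i)]
  simp only [← Finset.mul_sum]
  ring

end ScalarFormula

/-! ### Invariants and their germs at the base point. -/

section Isomorphism

variable {m k n : ℕ} {x₀ : Fin (m * k + n) → ℂ}

open Classical in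
/-- The elements of the parabolic subgroup `W₀`. -/
noncomputable def parabolicFinset (m k n : ℕ) : Finset (Equiv.Perm (Fin (m * k + n))) :=
  Finset.univ.filter (· ∈ parabolic m k n)

theorem mem_parabolicFinset {w : Equiv.Perm (Fin (m * k + n))} :
    w ∈ parabolicFinset m k n ↔ w ∈ parabolic m k n := by simp [parabolicFinset]

theorem card_parabolicFinset_ne_zero : ((parabolicFinset m k n).card : ℂ) ≠ 0 :=
  Nat.cast_ne_zero.2 (Finset.card_ne_zero_of_mem (mem_parabolicFinset.2 (one_mem _)))

/-- A germ near the orbit is the average of the translates of its germs at `x₀`. -/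
theorem sum_perm_extGerm (hk : 2 ≤ k) (hx₀ : IsGeneric (stratum m k n) x₀)
    (a : StratumGerm m k n x₀) :
    ∑ w, permStratum x₀ w⁻¹ (extGerm x₀ (germAt hk hx₀ (permStratum x₀ w a)))
      = ((parabolicFinset m k n).card : ℂ) • a := by
  classical
  refine eq_of_forall_germAt_perm hk hx₀ fun u => ?_
  -- At the point reached by `u`, only the summands with `u * w⁻¹` in the stabilizer are nonzero;
  -- there are |W₀| of them and each gives the whole germ.
  have h1 : ∀ w, germAt hk hx₀ (permStratum x₀ u (permStratum x₀ w⁻¹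
      (extGerm x₀ (germAt hk hx₀ (permStratum x₀ w a)))))
      = if u * w⁻¹ ∈ parabolicFinset m k n then germAt hk hx₀ (permStratum x₀ u a) else 0 := by
    intro w
    rw [← permStratum_mul]
    split_ifs with h
    · rw [mem_parabolicFinset] at h
      rw [germAt_perm_of_mem hk hx₀ h, germAt_extGerm, ← germAt_perm_of_mem hk hx₀ h,
        ← permStratum_mul, inv_mul_cancel_right]
    · exact germAt_perm_extGerm_of_notMem hk hx₀ (mt mem_parabolicFinset.2 h) _
  simp only [map_sum, h1, map_smul]
  refine (Equiv.sum_comp ((Equiv.inv _).trans (Equiv.mulLeft u)) fun v =>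
    if v ∈ parabolicFinset m k n then germAt hk hx₀ (permStratum x₀ u a) else 0).trans ?_
  rw [Finset.sum_ite_mem, Finset.univ_inter, Finset.sum_const, Nat.cast_smul_eq_nsmul]

variable {U : Type*} [AddCommGroup U] [Module ℂ U]
  (ρ : Representation ℂ (Equiv.Perm (Fin (m * k + n)))ᵐᵒᵖ U)

theorem rho_op_mul (u w : Equiv.Perm (Fin (m * k + n))) (v : U) :
    ρ (MulOpposite.op (u * w)) v = ρ (MulOpposite.op w) (ρ (MulOpposite.op u) v) := by
  rw [MulOpposite.op_mul, map_mul]; rfl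

/-- The projection of `U` onto `U^{W₀}` given by the average over `W₀`. -/
noncomputable def fixedProj : U →ₗ[ℂ] fixedVectors ρ :=
  LinearMap.codRestrict (fixedVectors ρ)
    (((parabolicFinset m k n).card : ℂ)⁻¹ • ∑ w ∈ parabolicFinset m k n, ρ (MulOpposite.op w))
    (by
      intro v u hu
      simp only [LinearMap.smul_apply, LinearMap.sum_apply, map_smul, map_sum, ← rho_op_mul]
      congr 1
      refine Finset.sum_bij (fun w _ => w * u) ?_ ?_ ?_ ?_
      · exact fun w hw => mem_parabolicFinset.2 (mul_mem (mem_parabolicFinset.1 hw) hu)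
      · exact fun w _ w' _ h => mul_right_cancel h
      · exact fun w hw => ⟨w * u⁻¹, mem_parabolicFinset.2
          (mul_mem (mem_parabolicFinset.1 hw) (inv_mem hu)), by simp⟩
      · exact fun _ _ => rfl)

theorem subtype_comp_fixedProj : (fixedVectors ρ).subtype ∘ₗ fixedProj ρ
    = ((parabolicFinset m k n).card : ℂ)⁻¹ • ∑ w ∈ parabolicFinset m k n, ρ (MulOpposite.op w) :=
  rfl

theorem fixedProj_comp_subtype : fixedProj ρ ∘ₗ (fixedVectors ρ).subtype = LinearMap.id := by
  ext v
  have h : ((fixedVectors ρ).subtype ∘ₗ fixedProj ρ) v = (v : U) := by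
    rw [subtype_comp_fixedProj, LinearMap.smul_apply, LinearMap.sum_apply,
      Finset.sum_congr rfl fun w hw => v.2 w (mem_parabolicFinset.1 hw), Finset.sum_const,
      ← Nat.cast_smul_eq_nsmul ℂ, inv_smul_smul₀ card_parabolicFinset_ne_zero]
  exact h

/-- The averaging projection splits the inclusion of U^{W₀}, and a split injection stays injective
after tensoring. Identities in U^{W₀} ⊗ 𝒪 can therefore be tested in U ⊗ 𝒪. -/
theorem rTensor_subtype_injective {M : Type*} [AddCommGroup M] [Module ℂ M] :
    Function.Injective ((fixedVectors ρ).subtype.rTensor M) := by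
  refine Function.LeftInverse.injective (g := (fixedProj ρ).rTensor M) fun G => ?_
  rw [← LinearMap.comp_apply, ← LinearMap.rTensor_comp, fixedProj_comp_subtype,
    LinearMap.rTensor_id, LinearMap.id_apply]

variable {ρ}

/-- Applying `w` to the coefficients in the invariance equation cancels the `w⁻¹` there.
Translations of germs are thus traded for the action on U, and reflections for the operators P_{rs}.
-/
theorem rTensor_eq_lTensor_perm {F : U ⊗[ℂ] StratumGerm m k n x₀} (hF : F ∈ diagInvariants ρ x₀)
    (w : Equiv.Perm (Fin (m * k + n))) :
    (ρ (MulOpposite.op w)).rTensor _ F = (permStratum x₀ w).lTensor U F := by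
  conv_lhs => rw [← hF w]
  rw [LinearMap.rTensor, ← LinearMap.comp_apply, ← TensorProduct.map_comp, LinearMap.id_comp]
  have h : ρ (MulOpposite.op w) ∘ₗ ρ (MulOpposite.op w⁻¹) = LinearMap.id := by
    ext v
    rw [LinearMap.comp_apply, ← rho_op_mul, inv_mul_cancel, MulOpposite.op_one, map_one]
    rfl
  rw [h]
  rfl

variable (ρ)

/-- The germ at `x₀` of an invariant, as an element of `U^{W₀} ⊗ 𝒪`. -/
noncomputable def invGermAt (hk : 2 ≤ k) (hx₀ : IsGeneric (stratum m k n) x₀) :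
    diagInvariants ρ x₀ →ₗ[ℂ] fixedVectors ρ ⊗[ℂ] AnGerm Set.univ {yCoord x₀} :=
  TensorProduct.map (fixedProj ρ) (germAt hk hx₀) ∘ₗ (diagInvariants ρ x₀).subtype

/-- The projection in `invGermAt` serves only to land in U^{W₀}; it changes nothing. On an
invariant, W₀ acting on the coefficients is W₀ translating the germ, which has no effect at x₀. -/
theorem rTensor_invGermAt (hk : 2 ≤ k) (hx₀ : IsGeneric (stratum m k n) x₀)
    (F : diagInvariants ρ x₀) :
    (fixedVectors ρ).subtype.rTensor _ (invGermAt ρ hk hx₀ F)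
      = (germAt hk hx₀).lTensor U (F : U ⊗[ℂ] StratumGerm m k n x₀) := by
  have h1 : (fixedVectors ρ).subtype.rTensor _ (invGermAt ρ hk hx₀ F)
      = (germAt hk hx₀).lTensor U (((fixedVectors ρ).subtype ∘ₗ fixedProj ρ).rTensor _
        (F : U ⊗[ℂ] StratumGerm m k n x₀)) := by
    rw [invGermAt, LinearMap.rTensor, LinearMap.rTensor, LinearMap.lTensor]
    simp only [← LinearMap.comp_apply, ← LinearMap.comp_assoc, ← TensorProduct.map_comp]
    rfl
  have h2 : ∀ w ∈ parabolicFinset m k n, (germAt hk hx₀).lTensor U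
      ((ρ (MulOpposite.op w)).rTensor _ (F : U ⊗[ℂ] StratumGerm m k n x₀))
      = (germAt hk hx₀).lTensor U (F : U ⊗[ℂ] StratumGerm m k n x₀) := by
    intro w hw
    rw [rTensor_eq_lTensor_perm F.2, ← LinearMap.comp_apply, ← LinearMap.lTensor_comp]
    congr 2
    ext a
    exact germAt_perm_of_mem hk hx₀ (mem_parabolicFinset.1 hw) a
  rw [h1, subtype_comp_fixedProj, LinearMap.rTensor_smul, ← LinearMap.coe_rTensorHom, map_sum]
  simp only [LinearMap.smul_apply, LinearMap.sum_apply, map_smul, map_sum,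
    LinearMap.coe_rTensorHom]
  rw [Finset.sum_congr rfl h2, Finset.sum_const, ← Nat.cast_smul_eq_nsmul ℂ,
    inv_smul_smul₀ card_parabolicFinset_ne_zero]

/-- The germs of an invariant at the other points of the orbit come from the one at x₀ by acting on
coefficients. The reconstruction of `sum_perm_extGerm`, tensored with U, then shows that |W₀| times
the invariant is zero. -/
theorem invGermAt_injective (hk : 2 ≤ k) (hx₀ : IsGeneric (stratum m k n) x₀) :
    Function.Injective (invGermAt ρ hk hx₀) := by
  refine (injective_iff_map_eq_zero _).2 fun F hF => ?_
  have h1 : (germAt hk hx₀).lTensor U (F : U ⊗[ℂ] StratumGerm m k n x₀) = 0 := by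
    rw [← rTensor_invGermAt, hF, map_zero]
  have h2 : ∑ w, permStratum x₀ w⁻¹ ∘ₗ extGerm x₀ ∘ₗ germAt hk hx₀ ∘ₗ permStratum x₀ w
      = ((parabolicFinset m k n).card : ℂ) • LinearMap.id := by
    ext a
    simpa only [LinearMap.sum_apply, LinearMap.comp_apply, LinearMap.smul_apply,
      LinearMap.id_apply] using sum_perm_extGerm hk hx₀ a
  have h3 := congrArg (fun L => L.lTensor U (F : U ⊗[ℂ] StratumGerm m k n x₀)) h2
  -- On `F` the innermost translation becomes an action on U, which commutes with taking the germ at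
  -- x₀, and that germ is zero.
  have h4 : ∀ w, (permStratum x₀ w⁻¹ ∘ₗ extGerm x₀ ∘ₗ germAt hk hx₀ ∘ₗ permStratum x₀ w).lTensor U
      (F : U ⊗[ℂ] StratumGerm m k n x₀) = 0 := by
    intro w
    rw [LinearMap.lTensor_comp, LinearMap.lTensor_comp, LinearMap.lTensor_comp]
    simp only [LinearMap.comp_apply]
    rw [← rTensor_eq_lTensor_perm F.2, ← LinearMap.comp_apply ((germAt hk hx₀).lTensor U),
      LinearMap.lTensor_comp_rTensor, ← LinearMap.rTensor_comp_lTensor, LinearMap.comp_apply, h1]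
    simp only [map_zero]
  rw [← LinearMap.coe_lTensorHom] at h3
  simp only [map_sum, LinearMap.sum_apply, LinearMap.coe_lTensorHom, h4, Finset.sum_const_zero,
    LinearMap.lTensor_smul, LinearMap.lTensor_id, LinearMap.smul_apply, LinearMap.id_apply] at h3
  exact Subtype.ext ((smul_eq_zero.1 h3.symm).resolve_left card_parabolicFinset_ne_zero)

/-- The invariant with a given germ at `x₀`, up to the factor `|W₀|`. -/
noncomputable def spread (x₀ : Fin (m * k + n) → ℂ) :
    fixedVectors ρ ⊗[ℂ] AnGerm Set.univ {yCoord x₀} →ₗ[ℂ] U ⊗[ℂ] StratumGerm m k n x₀ :=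
  ∑ w, TensorProduct.map (ρ (MulOpposite.op w⁻¹) ∘ₗ (fixedVectors ρ).subtype)
    (permStratum x₀ w ∘ₗ extGerm x₀)

theorem spread_mem (G : fixedVectors ρ ⊗[ℂ] AnGerm Set.univ {yCoord x₀}) :
    spread ρ x₀ G ∈ diagInvariants ρ x₀ := by
  intro u
  rw [spread, LinearMap.sum_apply, map_sum]
  refine (Finset.sum_congr rfl fun w _ => ?_).trans (Equiv.sum_comp (Equiv.mulLeft u) fun w =>
    TensorProduct.map (ρ (MulOpposite.op w⁻¹) ∘ₗ (fixedVectors ρ).subtype)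
      (permStratum x₀ w ∘ₗ extGerm x₀) G)
  rw [← LinearMap.comp_apply, ← TensorProduct.map_comp]
  refine congrArg₂ (fun A B => TensorProduct.map A B G) ?_ ?_
  · ext v
    simp only [LinearMap.comp_apply, Equiv.coe_mulLeft, mul_inv_rev, rho_op_mul]
  · ext a
    simp only [LinearMap.comp_apply, Equiv.coe_mulLeft, permStratum_mul]

/-- Only the summands with `w` in W₀ reach x₀, and on them `w` acts trivially both on the
coefficient and on the germ. -/
theorem lTensor_germAt_spread (hk : 2 ≤ k) (hx₀ : IsGeneric (stratum m k n) x₀)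
    (G : fixedVectors ρ ⊗[ℂ] AnGerm Set.univ {yCoord x₀}) :
    (germAt hk hx₀).lTensor U (spread ρ x₀ G)
      = ((parabolicFinset m k n).card : ℂ) • (fixedVectors ρ).subtype.rTensor _ G := by
  classical
  induction G using TensorProduct.induction_on with
  | zero => simp
  | add G G' h h' => rw [map_add, map_add, h, h', map_add, smul_add]
  | tmul v g =>
    have h1 : ∀ w : Equiv.Perm (Fin (m * k + n)),
        ρ (MulOpposite.op w⁻¹) (v : U) ⊗ₜ[ℂ] germAt hk hx₀ (permStratum x₀ w (extGerm x₀ g))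
        = if w ∈ parabolicFinset m k n then (v : U) ⊗ₜ[ℂ] g else 0 := by
      intro w
      split_ifs with h
      · rw [mem_parabolicFinset] at h
        rw [v.2 _ (inv_mem h), germAt_perm_of_mem hk hx₀ h, germAt_extGerm]
      · rw [germAt_perm_extGerm_of_notMem hk hx₀ (mt mem_parabolicFinset.2 h),
          TensorProduct.tmul_zero]
    simp only [spread, LinearMap.sum_apply, map_sum, TensorProduct.map_tmul, LinearMap.lTensor_tmul,
      LinearMap.comp_apply, Submodule.subtype_apply, h1, LinearMap.rTensor_tmul]
    rw [Finset.sum_ite_mem, Finset.univ_inter, Finset.sum_const, Nat.cast_smul_eq_nsmul]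

theorem invGermAt_surjective (hk : 2 ≤ k) (hx₀ : IsGeneric (stratum m k n) x₀) :
    Function.Surjective (invGermAt ρ hk hx₀) := by
  intro G
  refine ⟨⟨spread ρ x₀ (((parabolicFinset m k n).card : ℂ)⁻¹ • G), spread_mem ρ _⟩, ?_⟩
  apply rTensor_subtype_injective ρ
  rw [rTensor_invGermAt, lTensor_germAt_spread, map_smul,
    smul_inv_smul₀ card_parabolicFinset_ne_zero]

end Isomorphism

/-! ### Transport of the operator to the germs at the base point. -/

section Conjugation

variable {m k n : ℕ} {x₀ : Fin (m * k + n) → ℂ}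

/-- The germ at `x₀` of the translate by the transposition `(r, s)`. -/
noncomputable def germAtSwap (hk : 2 ≤ k) (hx₀ : IsGeneric (stratum m k n) x₀)
    (r s : Fin (m * k + n)) : StratumGerm m k n x₀ →ₗ[ℂ] AnGerm Set.univ {yCoord x₀} :=
  germAt hk hx₀ ∘ₗ permStratum x₀ (Equiv.swap r s)

/-- The germ at `x₀` of the sum of the squares of the Dunkl operators. -/
theorem germAt_comp_dunklLaplacian (hk : 2 ≤ k) (hx₀ : IsGeneric (stratum m k n) x₀) :
    let A := AnGerm Set.univ {yCoord x₀}
    let M : A → Module.End ℂ A := LinearMap.mulLeft ℂ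
    let K : A := (k : A)
    let sqrtK : ℂ := (Real.sqrt k : ℂ)
    let rootK : A := algebraMap ℂ _ sqrtK
    let Y : Fin m → A := fun i => coordGerm _ _ (Fin.castAdd n i)
    let Z : Fin n → A := fun j => coordGerm _ _ (Fin.natAdd m j)
    let dY : Fin m → Module.End ℂ A := fun i => pderivGerm _ (Fin.castAdd n i)
    let dZ : Fin n → Module.End ℂ A := fun j => pderivGerm _ (Fin.natAdd m j)
    let γ := germAt hk hx₀
    let P := germAtSwap hk hx₀
    γ ∘ₗ dunklLaplacian hk hx₀
      = (∑ i : Fin (m + n), (pderivGerm {yCoord x₀} i ∘ₗ pderivGerm {yCoord x₀} i) ∘ₗ γ)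
      + (∑ i : Fin n, ∑ j ∈ Finset.Ioi i,
          M (2 * Ring.inverse (K * (Z i - Z j) ^ 2)) ∘ₗ (γ - P (free i) (free j)))
      + (∑ i : Fin m, ∑ j : Fin n,
          M (2 * Ring.inverse ((Y i - rootK * Z j) ^ 2)) ∘ₗ
            ((k : ℂ) • γ - ∑ a, P (blk i a) (free j)))
      + (∑ i : Fin m, ∑ j ∈ Finset.Ioi i,
          M (2 * Ring.inverse ((Y i - Y j) ^ 2)) ∘ₗ
            ((k : ℂ) ^ 2 • γ - ∑ a, ∑ b, P (blk i a) (blk j b)))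
      - (∑ i : Fin n, ∑ j ∈ Finset.Ioi i,
          (M (2 * Ring.inverse (K * (Z i - Z j))) ∘ₗ (dZ i - dZ j)) ∘ₗ γ)
      - (∑ i : Fin m, ∑ j : Fin n,
          (M (2 * Ring.inverse (Y i - rootK * Z j)) ∘ₗ (dY i - sqrtK • dZ j)) ∘ₗ γ)
      - (∑ i : Fin m, ∑ j ∈ Finset.Ioi i,
          (M (2 * K * Ring.inverse (Y i - Y j)) ∘ₗ (dY i - dY j)) ∘ₗ γ) := by
  intro A M K sqrtK rootK Y Z dY dZ γ P
  ext a
  -- Both sides depend only on the germ, so the extension may be chosen constant along the fibres of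
  -- y near x₀, as the scalar formula requires.
  obtain ⟨f, rfl, hf⟩ := exists_representative hk hx₀ a
  have hk0 : (k : ℂ) ≠ 0 := Nat.cast_ne_zero.2 (by omega)
  have hγ : IsGermOf (γ (AnGerm.mk _ _ f)) fun y => f.1 (param y) := isGermOf_germAt hk hx₀ f
  have hP : ∀ r s, IsGermOf (P r s (AnGerm.mk _ _ f)) fun y => f.1 (param y ∘ Equiv.swap r s) :=
    fun r s => isGermOf_germAt_perm hk hx₀ _ f
  have hY : ∀ i, IsGermOf (Y i) fun y => y (Fin.castAdd n i) := fun i => IsGermOf.coord _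
  have hZ : ∀ j, IsGermOf (Z j) fun y => y (Fin.natAdd m j) := fun j => IsGermOf.coord _
  have hK : IsGermOf K fun _ => (k : ℂ) := IsGermOf.natCast k
  have hR : IsGermOf rootK fun _ => (Real.sqrt k : ℂ) := IsGermOf.const _
  have hdY : ∀ i, IsGermOf (dY i (γ (AnGerm.mk _ _ f))) _ := fun i => hγ.pderiv (Fin.castAdd n i)
  have hdZ : ∀ j, IsGermOf (dZ j (γ (AnGerm.mk _ _ f))) _ := fun j => hγ.pderiv (Fin.natAdd m j)
  refine ((isGermOf_germAt_dunklLaplacian hk hx₀ f).congr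
    (sum_dunklFun_dunklFun_param hk hx₀ f.2 hγ.analyticAt hf)).eq ?_
  simp only [LinearMap.add_apply, LinearMap.sub_apply, LinearMap.sum_apply, LinearMap.comp_apply,
    LinearMap.smul_apply, M, LinearMap.mulLeft_apply]
  refine ((((((IsGermOf.sum fun i _ => ?_).add ?_).add ?_).add ?_).sub ?_).sub ?_).sub ?_
  · exact (hγ.pderiv i).pderiv i
  · refine IsGermOf.sum fun i _ => IsGermOf.sum fun j hj => ?_
    exact (IsGermOf.two.mul ((hK.mul (((hZ i).sub (hZ j)).pow 2)).inverse (mul_ne_zero hk0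
      (pow_ne_zero 2 (yCoord_natAdd_ne hx₀ (Finset.mem_Ioi.1 hj).ne))))).mul (hγ.sub (hP _ _))
  · refine IsGermOf.sum fun i _ => IsGermOf.sum fun j _ => ?_
    exact (IsGermOf.two.mul ((((hY i).sub (hR.mul (hZ j))).pow 2).inverse
      (pow_ne_zero 2 (yCoord_castAdd_natAdd_ne hk hx₀ i j)))).mul
      ((hγ.smul _).sub (IsGermOf.sum fun a _ => hP _ _))
  · refine IsGermOf.sum fun i _ => IsGermOf.sum fun j hj => ?_
    exact (IsGermOf.two.mul ((((hY i).sub (hY j)).pow 2).inverse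
      (pow_ne_zero 2 (yCoord_castAdd_ne hk hx₀ (Finset.mem_Ioi.1 hj).ne)))).mul
      ((hγ.smul _).sub (IsGermOf.sum fun a _ => IsGermOf.sum fun b _ => hP _ _))
  · refine IsGermOf.sum fun i _ => IsGermOf.sum fun j hj => ?_
    exact (IsGermOf.two.mul ((hK.mul ((hZ i).sub (hZ j))).inverse (mul_ne_zero hk0
      (yCoord_natAdd_ne hx₀ (Finset.mem_Ioi.1 hj).ne)))).mul ((hdZ i).sub (hdZ j))
  · refine IsGermOf.sum fun i _ => IsGermOf.sum fun j _ => ?_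
    exact (IsGermOf.two.mul (((hY i).sub (hR.mul (hZ j))).inverse
      (yCoord_castAdd_natAdd_ne hk hx₀ i j))).mul ((hdY i).sub ((hdZ j).smul _))
  · refine IsGermOf.sum fun i _ => IsGermOf.sum fun j hj => ?_
    exact ((IsGermOf.two.mul hK).mul (((hY i).sub (hY j)).inverse
      (yCoord_castAdd_ne hk hx₀ (Finset.mem_Ioi.1 hj).ne))).mul ((hdY i).sub (hdY j))

variable {U : Type*} [AddCommGroup U] [Module ℂ U]
  {ρ : Representation ℂ (Equiv.Perm (Fin (m * k + n)))ᵐᵒᵖ U}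

section Intertwining

variable {V C A : Type*} [AddCommGroup V] [Module ℂ V] [AddCommGroup C] [Module ℂ C]
  [AddCommGroup A] [Module ℂ A] {ι : V →ₗ[ℂ] U} {γ : C →ₗ[ℂ] A} {F : U ⊗[ℂ] C} {G : V ⊗[ℂ] A}

/-- Here ι stands for the inclusion of U^{W₀}, γ for the germ at x₀, `F` for an invariant and `G`
for its germ. The hypothesis `hB` trades the operator on coefficients for a map of scalar germs, so
that a term of the spin operator becomes a term of the scalar formula. -/
theorem rTensor_map_apply (hG : ι.rTensor A G = γ.lTensor U F) {S : Module.End ℂ V}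
    {S' : Module.End ℂ U} (hS : ι ∘ₗ S = S' ∘ₗ ι) {B : C →ₗ[ℂ] A}
    (hB : TensorProduct.map S' γ F = B.lTensor U F) (L : Module.End ℂ A) :
    ι.rTensor A (TensorProduct.map S L G) = (L ∘ₗ B).lTensor U F := by
  calc ι.rTensor A (TensorProduct.map S L G)
      = TensorProduct.map (ι ∘ₗ S) L G := by
        rw [LinearMap.rTensor, ← LinearMap.comp_apply, ← TensorProduct.map_comp, LinearMap.id_comp]
    _ = TensorProduct.map S' L (ι.rTensor A G) := by
        rw [hS, LinearMap.rTensor, ← LinearMap.comp_apply, ← TensorProduct.map_comp,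
          LinearMap.comp_id]
    _ = L.lTensor U (TensorProduct.map S' γ F) := by
        rw [hG, LinearMap.lTensor, LinearMap.lTensor, ← LinearMap.comp_apply,
          ← LinearMap.comp_apply, ← TensorProduct.map_comp, ← TensorProduct.map_comp,
          LinearMap.comp_id, LinearMap.id_comp]
    _ = (L ∘ₗ B).lTensor U F := by rw [hB, LinearMap.lTensor_comp, LinearMap.comp_apply]

theorem rTensor_lTensor_apply (hG : ι.rTensor A G = γ.lTensor U F) (L : Module.End ℂ A) :
    ι.rTensor A (L.lTensor V G) = (L ∘ₗ γ).lTensor U F := by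
  rw [LinearMap.lTensor_comp, LinearMap.comp_apply, ← hG, ← LinearMap.comp_apply,
    ← LinearMap.comp_apply, LinearMap.rTensor_comp_lTensor, LinearMap.lTensor_comp_rTensor]

theorem map_sub_apply_eq {S T : Module.End ℂ U} {B D : C →ₗ[ℂ] A}
    (h : TensorProduct.map S γ F = B.lTensor U F) (h' : TensorProduct.map T γ F = D.lTensor U F) :
    TensorProduct.map (S - T) γ F = (B - D).lTensor U F := by
  rw [LinearMap.lTensor_sub, LinearMap.sub_apply, ← h, ← h']
  exact congrArg (fun L => L F) ((TensorProduct.mapBilinear (RingHom.id ℂ) U C U A).map_sub₂ S T γ)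

theorem map_sum_apply_eq {κ : Type*} {s : Finset κ} {S : κ → Module.End ℂ U} {B : κ → C →ₗ[ℂ] A}
    (h : ∀ i ∈ s, TensorProduct.map (S i) γ F = (B i).lTensor U F) :
    TensorProduct.map (∑ i ∈ s, S i) γ F = (∑ i ∈ s, B i).lTensor U F := by
  have h1 : TensorProduct.map (∑ i ∈ s, S i) γ = ∑ i ∈ s, TensorProduct.map (S i) γ :=
    LinearMap.map_sum₂ (TensorProduct.mapBilinear (RingHom.id ℂ) U C U A) s S γ
  rw [h1, LinearMap.sum_apply, Finset.sum_congr rfl h, ← LinearMap.coe_lTensorHom, map_sum,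
    LinearMap.sum_apply]

end Intertwining

theorem map_natCast_apply {C A : Type*} [AddCommGroup C] [Module ℂ C] [AddCommGroup A] [Module ℂ A]
    (l : ℕ) (γ : C →ₗ[ℂ] A) (F : U ⊗[ℂ] C) :
    TensorProduct.map (l : Module.End ℂ U) γ F = ((l : ℂ) • γ).lTensor U F := by
  have h : (l : Module.End ℂ U) = (l : ℂ) • LinearMap.id := by
    ext v
    simp [Nat.cast_smul_eq_nsmul]
  rw [h, TensorProduct.map_smul_left, LinearMap.lTensor_smul]
  rfl

/-- Invariance enters the computation of the operator here: the spin operator P_{rs} at x₀ is the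
reflection s_{rs} of the germ. -/
theorem map_transp_apply (hk : 2 ≤ k) (hx₀ : IsGeneric (stratum m k n) x₀)
    {F : U ⊗[ℂ] StratumGerm m k n x₀} (hF : F ∈ diagInvariants ρ x₀) (r s : Fin (m * k + n)) :
    TensorProduct.map (transp ρ r s) (germAt hk hx₀) F
      = (germAtSwap hk hx₀ r s).lTensor U F := by
  rw [germAtSwap, LinearMap.lTensor_comp, LinearMap.comp_apply, ← rTensor_eq_lTensor_perm hF,
    ← LinearMap.comp_apply, LinearMap.lTensor_comp_rTensor]
  rfl

theorem coe_transpBF_apply (i : Fin m) (j : Fin n) (v : fixedVectors ρ) :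
    (transpBF ρ i j v : U) = ∑ a, transp ρ (blk i a) (free j) (v : U) := by
  show (∑ a, transp ρ (blk i a) (free j)) (v : U) = _
  rw [LinearMap.sum_apply]

theorem coe_transpBB_apply (i j : Fin m) (v : fixedVectors ρ) :
    (transpBB ρ i j v : U) = ∑ a, ∑ b, transp ρ (blk i a) (blk j b) (v : U) := by
  show (∑ a, ∑ b, transp ρ (blk i a) (blk j b)) (v : U) = _
  simp only [LinearMap.sum_apply]

/-- The action of the deformed Calogero-Moser operator on the germ at `x₀` of an invariant. -/
theorem rTensor_deformedCM (hk : 2 ≤ k) (hx₀ : IsGeneric (stratum m k n) x₀)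
    {F : U ⊗[ℂ] StratumGerm m k n x₀} (hF : F ∈ diagInvariants ρ x₀)
    {G : fixedVectors ρ ⊗[ℂ] AnGerm Set.univ {yCoord x₀}}
    (hG : (fixedVectors ρ).subtype.rTensor _ G = (germAt hk hx₀).lTensor U F) :
    (fixedVectors ρ).subtype.rTensor _ (deformedCM ρ (yCoord x₀) G)
      = (germAt hk hx₀ ∘ₗ dunklLaplacian hk hx₀).lTensor U F := by
  have hone : TensorProduct.map (1 : Module.End ℂ U) (germAt hk hx₀) F
      = (germAt hk hx₀).lTensor U F := rfl
  have hsq : TensorProduct.map ((k : Module.End ℂ U) ^ 2) (germAt hk hx₀) F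
      = ((k : ℂ) ^ 2 • germAt hk hx₀).lTensor U F := by
    rw [← Nat.cast_pow, map_natCast_apply, Nat.cast_pow]
  have hFF : ∀ i j L, (fixedVectors ρ).subtype.rTensor _
      (TensorProduct.map (1 - transpFF ρ i j) L G)
      = (L ∘ₗ (germAt hk hx₀ - germAtSwap hk hx₀ (free i) (free j))).lTensor U F := fun i j L =>
    rTensor_map_apply hG (S' := 1 - transp ρ (free i) (free j)) (by ext v; rfl)
      (map_sub_apply_eq hone (map_transp_apply hk hx₀ hF _ _)) L
  have hBF : ∀ i j L, (fixedVectors ρ).subtype.rTensor _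
      (TensorProduct.map ((k : Module.End ℂ (fixedVectors ρ)) - transpBF ρ i j) L G)
      = (L ∘ₗ ((k : ℂ) • germAt hk hx₀
        - ∑ a, germAtSwap hk hx₀ (blk i a) (free j))).lTensor U F := fun i j L =>
    rTensor_map_apply hG
      (S' := (k : Module.End ℂ U) - ∑ a, transp ρ (blk i a) (free j))
      (by ext v; simp [coe_transpBF_apply])
      (map_sub_apply_eq (map_natCast_apply _ _ _)
        (map_sum_apply_eq fun a _ => map_transp_apply hk hx₀ hF _ _)) L
  have hBB : ∀ i j L, (fixedVectors ρ).subtype.rTensor _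
      (TensorProduct.map ((k : Module.End ℂ (fixedVectors ρ)) ^ 2 - transpBB ρ i j) L G)
      = (L ∘ₗ ((k : ℂ) ^ 2 • germAt hk hx₀
        - ∑ a, ∑ b, germAtSwap hk hx₀ (blk i a) (blk j b))).lTensor U F := fun i j L =>
    rTensor_map_apply hG
      (S' := (k : Module.End ℂ U) ^ 2 - ∑ a, ∑ b, transp ρ (blk i a) (blk j b))
      (by ext v; simp [coe_transpBB_apply, pow_two])
      (map_sub_apply_eq hsq (map_sum_apply_eq fun a _ => map_sum_apply_eq fun b _ =>
        map_transp_apply hk hx₀ hF _ _)) L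
  -- Both sides are now the same sum, term by term, of scalar germ maps tensored with U and applied
  -- to `F`.
  rw [germAt_comp_dunklLaplacian]
  simp only [deformedCM, LinearMap.add_apply, LinearMap.sub_apply, LinearMap.sum_apply, map_add,
    map_sub, map_sum, hFF, hBF, hBB, rTensor_lTensor_apply hG]
  simp only [← LinearMap.coe_lTensorHom, map_add, map_sub, map_sum, LinearMap.add_apply,
    LinearMap.sub_apply, LinearMap.sum_apply]

end Conjugation

end SpinCM

theorem proposition3p6 (m k n : ℕ) (_hm : 1 ≤ m) (hk : 2 ≤ k)
    {U : Type*} [AddCommGroup U] [Module ℂ U]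
    (ρ : Representation ℂ (Equiv.Perm (Fin (m * k + n)))ᵐᵒᵖ U)
    (x₀ : Fin (m * k + n) → ℂ)
    (hx₀ : SpinCM.IsGeneric (SpinCM.stratum m k n) x₀) :
    ∃ e : SpinCM.diagInvariants ρ x₀ ≃ₗ[ℂ]
        SpinCM.fixedVectors ρ ⊗[ℂ] SpinCM.AnGerm Set.univ {SpinCM.yCoord x₀},
      (∀ F : SpinCM.diagInvariants ρ x₀,
        (SpinCM.fixedVectors ρ).subtype.rTensor (SpinCM.AnGerm Set.univ {SpinCM.yCoord x₀}) (e F)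
          = (SpinCM.germAt hk hx₀).lTensor U (F : U ⊗[ℂ] SpinCM.StratumGerm m k n x₀)) ∧
      e.conj (SpinCM.invLaplacian ρ hk hx₀) = SpinCM.deformedCM ρ (SpinCM.yCoord x₀) := by
  let e := LinearEquiv.ofBijective (SpinCM.invGermAt ρ hk hx₀)
    ⟨SpinCM.invGermAt_injective ρ hk hx₀, SpinCM.invGermAt_surjective ρ hk hx₀⟩
  have he : ∀ F : SpinCM.diagInvariants ρ x₀,
      (SpinCM.fixedVectors ρ).subtype.rTensor (SpinCM.AnGerm Set.univ {SpinCM.yCoord x₀}) (e F)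
        = (SpinCM.germAt hk hx₀).lTensor U (F : U ⊗[ℂ] SpinCM.StratumGerm m k n x₀) :=
    SpinCM.rTensor_invGermAt ρ hk hx₀
  refine ⟨e, he, LinearMap.ext fun G => ?_⟩
  -- Every argument is the germ of an invariant `F`, and after the inclusion of U^{W₀} in U both
  -- sides are the germ at x₀ of ∑ ∇_i² `F`.
  obtain ⟨F, rfl⟩ := e.surjective G
  apply SpinCM.rTensor_subtype_injective ρ
  rw [SpinCM.rTensor_deformedCM hk hx₀ F.2 (he F), LinearEquiv.conj_apply_apply,
    LinearEquiv.symm_apply_apply, he, LinearMap.lTensor_comp]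
  rfl
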